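/- Let $\sigma\in\mathbb{R}$, $\mathbf{q}_0\in\mathbb{C}^2\setminus\{0\}$, $q_0=\|\mathbf{q}_0\|>0$, $\mathbf{q}_\pm=e^{i\delta_\pm}\mathbf{q}_0$ with $\delta_\pm\in\mathbb{R}$, and let $\mathbf{q}(x,t)\in\mathbb{C}^2$ (for instance a solution of the coupled Lakshmanan–Porsezian–Daniel equation with boundary values $\mathbf{q}_\pm$ at $x\to\pm\infty$). Fix $t$ such that $\mathbf{q}(\cdot,t)-\mathbf{q}_-\in L^1(-\infty,a)$ and $\mathbf{q}(\cdot,t)-\mathbf{q}_+\in L^1(a,\infty)$ for every $a\in\mathbb{R}$. For $z\ne0$ put $k=\frac12(z-q_0^2/z)$, $\lambda=\frac12(z+q_0^2/z)$, $\Lambda_1=\mathrm{diag}(-\lambda,k,\lambda)$, $\Omega=\mathrm{diag}(\delta_1,\delta_2,\delta_3)$ with $\delta_1=-\lambda x+2(k^2+k\lambda-4k^3\lambda\sigma+2k\lambda\sigma q_0^2)t$, $\delta_2=kx+(8k^4\sigma-3\sigma q_0^4-q_0^2)t$, $\delta_3=\lambda x+2(k^2-k\lambda+4k^3\lambda\sigma-2k\lambda\sigma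 q_0^2)t$, $$\mathbf{Q}(\mathbf{q})=\begin{pmatrix}0&\mathbf{q}^\dagger\\-\mathbf{q}&0\end{pmatrix},\qquad \mathbf{Y}_\pm(z)=\begin{pmatrix}1&0&-iq_0/z\\-\frac{i}{z}\mathbf{q}_\pm&\mathbf{q}_\pm^\perp/q_0&\mathbf{q}_\pm/q_0\end{pmatrix},\qquad (v_1,v_2)^{\perp}=(\bar v_2,-\bar v_1)^T .$$ For real $z\ne0$ let $\nu_\pm(x,z)$ be the continuous solutions, bounded near $\pm\infty$, of $$\nu_\pm(x)=\mathbf{Y}_\pm+\int_{\pm\infty}^x \mathbf{Y}_\pm e^{i(x-r)\Lambda_1}\mathbf{Y}_\pm^{-1}\big(\mathbf{Q}(\mathbf{q}(r,t))-\mathbf{Q}(\mathbf{q}_\pm)\big)\nu_\pm(r)e^{-i(x-r)\Lambda_1}\,dr ,$$ let $\psi_\pm=\nu_\pm e^{i\Omega}$ be the Jost eigenfunctions, and define the scattering matrix $\mathbf{S}(z)=(s_{ij}(z))$ by $\psi_-=\psi_+\mathbf{S}$, and $\mathbf{H}=(h_{ij})=\mathbf{S}^{-1}$. Let $U_1=\{\mathrm{Im}\,z>0,|z|>q_0\}$,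 $U_2=\{\mathrm{Im}\,z<0,|z|>q_0\}$, $U_3=\{\mathrm{Im}\,z<0,|z|<q_0\}$, $U_4=\{\mathrm{Im}\,z>0,|z|<q_0\}$. Then the diagonal coefficients extend from the real axis as follows: $s_{11}$ to $U_1$, $h_{11}$ to $U_2$ (each from $|z|>q_0$), $h_{33}$ to $U_3$, $s_{33}$ to $U_4$ (each from $0<|z|<q_0$), $s_{22}$ to $\{\mathrm{Im}\,z<0\}$ and $h_{22}$ to $\{\mathrm{Im}\,z>0\}$ (each from $z\neq0$), where each extension is analytic in the stated open set and continuous up to the stated real points. For any such extensions, denoted by the same letters, zeros come in symmetric quartets: (1) if $\mathrm{Im}\,z>0$, then $h_{22}(z)=0\iff s_{22}(z^*)=0\iff s_{22}(-q_0^2/z^*)=0\iff h_{22}(-q_0^2/z)=0$; (2) if $z\in U_1$, then $s_{11}(z)=0\iff h_{11}(z^*)=0\iff h_{33}(-q_0^2/z^*)=0\iff s_{33}(-q_0^2/z)=0$. -/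

import Mathlib

open MeasureTheory

noncomputable section

namespace CoupledLPD

/-- Values of the potential: two-component complex vectors with the Hermitian norm. -/
abbrev V := EuclideanSpace ℂ (Fin 2)

/-- `3 × 3` complex matrices. -/
abbrev M3 := Matrix (Fin 3) (Fin 3) ℂ

/-- The spectral parameter `k = (z - q₀² / z) / 2` in terms of the uniformization variable. -/
def specK (q₀ : ℝ) (z : ℂ) : ℂ := (z - (q₀ : ℂ) ^ 2 / z) / 2

/-- `λ = (z + q₀² / z) / 2`, so that `λ² = k² + q₀²`. -/
def specLam (q₀ : ℝ) (z : ℂ) : ℂ := (z + (q₀ : ℂ) ^ 2 / z) / 2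

/-- `J = diag (1, -1, -1)`. -/
def matJ : M3 := Matrix.diagonal ![1, -1, -1]

/-- The block matrix `Q = [[0, q†], [-q, 0]]`. -/
def matQ (q : V) : M3 :=
  !![0, star (q 0), star (q 1);
     -(q 0), 0, 0;
     -(q 1), 0, 0]

/-- The matrix `A = -i k J + Q` of the spatial part `ψ_x = A ψ` of the Lax pair. -/
def matA (k : ℂ) (q : V) : M3 := -(Complex.I * k) • matJ + matQ q

/-- The eigenvector matrix of `A` at a constant background `q`, `‖q‖ = q₀`.  Its columns are
`(1, -i q / z)`, `(0, q^⊥ / q₀)` with `q^⊥ = (q₂, -q₁)†`, and `(-i q₀ / z, q / q₀)`. -/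
def matY (q₀ : ℝ) (q : V) (z : ℂ) : M3 :=
  !![1, 0, -(Complex.I * q₀ / z);
     -(Complex.I / z) * q 0, star (q 1) / q₀, q 0 / q₀;
     -(Complex.I / z) * q 1, -star (q 0) / q₀, q 1 / q₀]

/-- The diagonal of `Λ₁ = diag (-λ, k, λ)`. -/
def lam1 (q₀ : ℝ) (z : ℂ) : Fin 3 → ℂ :=
  ![-specLam q₀ z, specK q₀ z, specLam q₀ z]

/-- The matrix `exp (i s Λ₁)`. -/
def expLam1 (q₀ : ℝ) (z : ℂ) (s : ℝ) : M3 :=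
  Matrix.diagonal fun j => Complex.exp (Complex.I * s * lam1 q₀ z j)

/-- The phases `δ₁, δ₂, δ₃`, i.e. the diagonal of `Ω(x, t, z)`. -/
def phase (σ q₀ x t : ℝ) (z : ℂ) : Fin 3 → ℂ :=
  let k := specK q₀ z
  let l := specLam q₀ z
  ![-l * x + 2 * (k ^ 2 + k * l - 4 * k ^ 3 * l * σ + 2 * k * l * σ * q₀ ^ 2) * t,
    k * x + (8 * k ^ 4 * σ - 3 * σ * q₀ ^ 4 - q₀ ^ 2) * t,
    l * x + 2 * (k ^ 2 - k * l + 4 * k ^ 3 * l * σ - 2 * k * l * σ * q₀ ^ 2) * t]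

/-- The matrix `exp (i Ω(x, t, z))`. -/
def expOmega (σ q₀ x t : ℝ) (z : ℂ) : M3 :=
  Matrix.diagonal fun j => Complex.exp (Complex.I * phase σ q₀ x t z j)

/-- The integrand `Y e^{i(x-r)Λ₁} Y⁻¹ (A(r) - A_∞) ν(r) e^{-i(x-r)Λ₁}` of the Volterra equations,
where `qInf` is the boundary value of the potential `u`. -/
def volterraIntegrand (q₀ : ℝ) (qInf : V) (u : ℝ → V) (z : ℂ) (ν : ℝ → M3) (x r : ℝ) : M3 :=
  matY q₀ qInf z * expLam1 q₀ z (x - r) * (matY q₀ qInf z)⁻¹ *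
    (matA (specK q₀ z) (u r) - matA (specK q₀ z) qInf) * ν r * expLam1 q₀ z (-(x - r))

/-- `ν` is the modified Jost eigenfunction `ν₋(·, z)` of the potential `u` with `u → qm` at `-∞`:
it is continuous, bounded near `-∞`, and solves
`ν(x) = Y₋ + ∫_{-∞}^x Y₋ e^{i(x-r)Λ₁} Y₋⁻¹ (A - A₋)(r) ν(r) e^{-i(x-r)Λ₁} dr`
(the integral is taken entrywise). -/
structure IsJostMinus (q₀ : ℝ) (qm : V) (u : ℝ → V) (z : ℂ) (ν : ℝ → M3) : Prop where
  continuous : Continuous ν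
  bounded : ∃ C : ℝ, ∀ x ≤ 0, ∀ i j, ‖ν x i j‖ ≤ C
  volterra : ∀ x i j, ν x i j =
    matY q₀ qm z i j + ∫ r in Set.Iic x, volterraIntegrand q₀ qm u z ν x r i j

/-- `ν` is the modified Jost eigenfunction `ν₊(·, z)` of the potential `u` with `u → qp` at `+∞`:
it is continuous, bounded near `+∞`, and solves
`ν(x) = Y₊ + ∫_{+∞}^x Y₊ e^{i(x-r)Λ₁} Y₊⁻¹ (A - A₊)(r) ν(r) e^{-i(x-r)Λ₁} dr`. -/
structure IsJostPlus (q₀ : ℝ) (qp : V) (u : ℝ → V) (z : ℂ) (ν : ℝ → M3) : Prop where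
  continuous : Continuous ν
  bounded : ∃ C : ℝ, ∀ x ≥ 0, ∀ i j, ‖ν x i j‖ ≤ C
  volterra : ∀ x i j, ν x i j =
    matY q₀ qp z i j - ∫ r in Set.Ioi x, volterraIntegrand q₀ qp u z ν x r i j

/-- `S` is the scattering matrix at `z` of the potential `u = q(·, t)`: `ψ₋ = ψ₊ S` for the Jost
eigenfunctions `ψ± = ν± e^{iΩ}`. -/
def IsScatteringMatrix (σ q₀ : ℝ) (qm qp : V) (u : ℝ → V) (t : ℝ) (z : ℂ) (S : M3) : Prop :=
  ∃ νm νp : ℝ → M3, IsJostMinus q₀ qm u z νm ∧ IsJostPlus q₀ qp u z νp ∧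
    ∀ x : ℝ, νm x * expOmega σ q₀ x t z = νp x * expOmega σ q₀ x t z * S

/-- `F` is analytic on `D`, continuous on `D ∪ B`, and its value at each `z ∈ B` is the entry
`s_jj(z)` of the scattering matrix `S(z)`. -/
structure IsSCoeff (σ q₀ : ℝ) (qm qp : V) (u : ℝ → V) (t : ℝ) (j : Fin 3) (D B : Set ℂ)
    (F : ℂ → ℂ) : Prop where
  analytic : AnalyticOnNhd ℂ F D
  continuousOn : ContinuousOn F (D ∪ B)
  boundary : ∀ z ∈ B, ∃ S, IsScatteringMatrix σ q₀ qm qp u t z S ∧ F z = S j j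

/-- The same for the entry `h_jj(z)` of the inverse `H(z) = S(z)⁻¹` of the scattering matrix. -/
structure IsHCoeff (σ q₀ : ℝ) (qm qp : V) (u : ℝ → V) (t : ℝ) (j : Fin 3) (D B : Set ℂ)
    (F : ℂ → ℂ) : Prop where
  analytic : AnalyticOnNhd ℂ F D
  continuousOn : ContinuousOn F (D ∪ B)
  boundary : ∀ z ∈ B, ∃ S, IsScatteringMatrix σ q₀ qm qp u t z S ∧ IsUnit S.det ∧ F z = S⁻¹ j j

/-- `U₁ = {Im z > 0, |z| > q₀}`. -/
def U1 (q₀ : ℝ) : Set ℂ := {z | 0 < z.im ∧ q₀ < ‖z‖}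

/-- `U₂ = {Im z < 0, |z| > q₀}`. -/
def U2 (q₀ : ℝ) : Set ℂ := {z | z.im < 0 ∧ q₀ < ‖z‖}

/-- `U₃ = {Im z < 0, |z| < q₀}`. -/
def U3 (q₀ : ℝ) : Set ℂ := {z | z.im < 0 ∧ ‖z‖ < q₀}

/-- `U₄ = {Im z > 0, |z| < q₀}`. -/
def U4 (q₀ : ℝ) : Set ℂ := {z | 0 < z.im ∧ ‖z‖ < q₀}

/-- The open upper half-plane. -/
def upper : Set ℂ := {z | 0 < z.im}

/-- The open lower half-plane. -/
def lower : Set ℂ := {z | z.im < 0}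

/-- The real axis without the origin. -/
def realAxis : Set ℂ := {z | z.im = 0 ∧ z ≠ 0}

/-- The real points with `|z| > q₀`. -/
def realOuter (q₀ : ℝ) : Set ℂ := {z | z.im = 0 ∧ q₀ < ‖z‖}

/-- The real points with `0 < |z| < q₀`. -/
def realInner (q₀ : ℝ) : Set ℂ := {z | z.im = 0 ∧ z ≠ 0 ∧ ‖z‖ < q₀}

/-- The six analytic scattering coefficients `s₁₁` on `U₁`, `s₂₂` on `{Im z < 0}`, `s₃₃` on `U₄`,
`h₁₁` on `U₂`, `h₂₂` on `{Im z > 0}` and `h₃₃` on `U₃` of the potential `u = q(·, t)`: the analytic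
continuations of the diagonal entries of `S` and `H = S⁻¹` from the real axis. -/
structure AreScatteringCoefficients (σ q₀ : ℝ) (qm qp : V) (u : ℝ → V) (t : ℝ)
    (s₁₁ s₂₂ s₃₃ h₁₁ h₂₂ h₃₃ : ℂ → ℂ) : Prop where
  isS₁₁ : IsSCoeff σ q₀ qm qp u t 0 (U1 q₀) (realOuter q₀) s₁₁
  isS₂₂ : IsSCoeff σ q₀ qm qp u t 1 lower realAxis s₂₂
  isS₃₃ : IsSCoeff σ q₀ qm qp u t 2 (U4 q₀) (realInner q₀) s₃₃
  isH₁₁ : IsHCoeff σ q₀ qm qp u t 0 (U2 q₀) (realOuter q₀) h₁₁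
  isH₂₂ : IsHCoeff σ q₀ qm qp u t 1 upper realAxis h₂₂
  isH₃₃ : IsHCoeff σ q₀ qm qp u t 2 (U3 q₀) (realInner q₀) h₃₃

end CoupledLPD

end

/-! For real `z` the matrix `A = -ikJ + Q` is anti-Hermitian, so the products `ψ±†ψ±` and `ψ₊†ψ₋` do
not depend on `x`. Letting `x → ±∞` gives `ψ±†ψ± = Y†Y = C` with `C = diag(1 + q₀²/z², 1, 1 +
q₀²/z²)` (`jostCol_dotProduct_same`). Hence `S = C⁻¹ψ₊†ψ₋` and `H = S⁻¹ = C⁻¹ψ₋†ψ₊`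
(`isScatteringMatrix_iff`, `scatMat_mul_scatInv`). On the diagonal the phases cancel, so `s_jj` is
`c_j⁻¹` times the Hermitian product of the `j`-th columns of `ν₊` and `ν₋` at `x = 0`.

To continue this off the axis, the column of `ν₊`, which enters conjugated, is evaluated at `z*`;
the product is then holomorphic in `z` (`sCoef`), and `h_jj(z)` is the conjugate of `s_jj(z*)`
(`hCoef`). Each column solves a Volterra equation with kernel `exp(s(A_∞ - iλ_j))`, which is bounded
for `s ≥ 0` when `Im(λ_l - λ_j) ≥ 0` for all `l` and `Y` is invertible. There the Neumann series
converges locally uniformly in `z` and inherits continuity and analyticity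
(`volterraSol_parameter`). At `z = ±iq₀` the matrix `Y` is singular, but the kernel is still
holomorphic, and the maximum principle bounds it near these points (`jostKernel_locally_bounded`).

The quartets come from two symmetries. Conjugation relates `h_jj(z)` to `s_jj(z*)` by construction.
The map `z ↦ -q₀²/z` fixes `k` and negates `λ`; it therefore fixes the second column and exchanges
the first with a multiple of the third, so that `s₂₂` is invariant and `s₁₁`, `s₃₃` are exchanged
(`sCoef_one_symm`, `sCoef_zero_symm`). Finally, an arbitrary extension with the same real boundary
values coincides with these explicit ones (`AreScatteringCoefficients.eqOn`), by a boundary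
uniqueness principle resting on the maximum modulus theorem. -/

noncomputable section

namespace CoupledLPD

open Set Filter Topology

/-! ### Volterra equations on a half-line with integrable perturbation -/

section Volterra

lemma setIntegral_Iic_eq_add {F : Type*} [NormedAddCommGroup F] [NormedSpace ℝ F] {h : ℝ → F}
    (hh : ∀ a, IntegrableOn h (Iic a)) (a x : ℝ) :
    ∫ r in Iic x, h r = (∫ r in Iic a, h r) + ∫ r in a..x, h r := by
  rw [← intervalIntegral.integral_Iic_sub_Iic (hh a) (hh x)]; abel

lemma locallyIntegrable_of_Iic {F : Type*} [NormedAddCommGroup F] {h : ℝ → F}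
    (hh : ∀ a, IntegrableOn h (Iic a)) : LocallyIntegrable h :=
  fun x => ⟨Iic (x + 1), Iic_mem_nhds (by linarith), hh _⟩

/-- Allows a vector-valued integral to be compared with the real-valued integral of the norm. -/
lemma absolutelyContinuous_of_dist_le {X Y : Type*} [PseudoMetricSpace X] [PseudoMetricSpace Y]
    {f : ℝ → X} {g : ℝ → Y} {a b : ℝ} (hg : AbsolutelyContinuousOnInterval g a b)
    (h : ∀ x ∈ uIcc a b, ∀ y ∈ uIcc a b, dist (f x) (f y) ≤ dist (g x) (g y)) :
    AbsolutelyContinuousOnInterval f a b := by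
  unfold AbsolutelyContinuousOnInterval at *
  refine squeeze_zero' (Eventually.of_forall fun _ => Finset.sum_nonneg fun _ _ => dist_nonneg)
    ?_ hg
  rw [eventually_inf_principal]
  filter_upwards with E hE
  exact Finset.sum_le_sum fun i hi => h _ (hE.1 i hi).1 _ (hE.1 i hi).2

/-- The indefinite integral is absolutely continuous and a.e. differentiable. -/
lemma absolutelyContinuous_integral_Iic {F : Type*} [NormedAddCommGroup F] [NormedSpace ℝ F]
    {h : ℝ → F} (hh : ∀ a, IntegrableOn h (Iic a)) (a b : ℝ) :
    AbsolutelyContinuousOnInterval (fun x => ∫ r in Iic x, h r) a b := by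
  have hi : IntervalIntegrable (fun r => ‖h r‖) volume a b :=
    ((locallyIntegrable_of_Iic fun a => (hh a).norm).integrableOn_isCompact
      isCompact_uIcc).intervalIntegrable
  refine absolutelyContinuous_of_dist_le
    (hi.absolutelyContinuousOnInterval_intervalIntegral left_mem_uIcc) fun x _ y _ => ?_
  have hii : ∀ c d, IntervalIntegrable (fun r => ‖h r‖) volume c d := fun c d =>
    ((locallyIntegrable_of_Iic fun a => (hh a).norm).integrableOn_isCompact
      isCompact_uIcc).intervalIntegrable
  rw [dist_comm, dist_comm (∫ _ in a..x, _), dist_eq_norm, dist_eq_norm,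
    intervalIntegral.integral_Iic_sub_Iic (hh x) (hh y),
    intervalIntegral.integral_interval_sub_left (hii _ _) (hii _ _), Real.norm_eq_abs]
  exact intervalIntegral.norm_integral_le_abs_integral_norm

lemma ae_hasDerivAt_integral_Iic {F : Type*} [NormedAddCommGroup F] [NormedSpace ℝ F]
    [CompleteSpace F] {h : ℝ → F} (hh : ∀ a, IntegrableOn h (Iic a)) :
    ∀ᵐ x, HasDerivAt (fun x => ∫ r in Iic x, h r) (h x) x := by
  filter_upwards [LocallyIntegrable.ae_hasDerivAt_integral (locallyIntegrable_of_Iic hh)] with x hx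
  exact ((hx 0).const_add (∫ r in Iic 0, h r)).congr_of_eventuallyEq
    (Eventually.of_forall fun y => setIntegral_Iic_eq_add hh 0 y)

lemma continuous_integral_Iic {F : Type*} [NormedAddCommGroup F] [NormedSpace ℝ F]
    {h : ℝ → F} (hh : ∀ a, IntegrableOn h (Iic a)) :
    Continuous fun x => ∫ r in Iic x, h r := by
  refine continuous_iff_continuousAt.2 fun x => ?_
  exact (absolutelyContinuous_integral_Iic hh (x - 1) (x + 1)).continuousOn.continuousAt
    (by rw [uIcc_of_le (by linarith)]; exact Icc_mem_nhds (by linarith) (by linarith))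

lemma monotone_integral_Iic {w : ℝ → ℝ} (hw : ∀ a, IntegrableOn w (Iic a)) (hw0 : ∀ r, 0 ≤ w r) :
    Monotone fun x => ∫ r in Iic x, w r := fun _ y hxy =>
  setIntegral_mono_set (hw y) (Eventually.of_forall hw0) (Iic_subset_Iic.2 hxy).eventuallyLE

lemma integral_Iic_nonneg {w : ℝ → ℝ} (hw0 : ∀ r, 0 ≤ w r) (x : ℝ) : 0 ≤ ∫ r in Iic x, w r :=
  integral_nonneg hw0

lemma integrableOn_mul_pow_integral_Iic {w : ℝ → ℝ} (hw : ∀ a, IntegrableOn w (Iic a))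
    (hw0 : ∀ r, 0 ≤ w r) (n : ℕ) (a : ℝ) :
    IntegrableOn (fun r => (∫ s in Iic r, w s) ^ n * w r) (Iic a) := by
  refine (hw a).bdd_mul (c := (∫ s in Iic a, w s) ^ n)
    ((continuous_integral_Iic hw).pow n).aestronglyMeasurable ?_
  filter_upwards [ae_restrict_mem measurableSet_Iic] with r hr
  rw [Real.norm_of_nonneg (pow_nonneg (integral_Iic_nonneg hw0 r) n)]
  exact pow_le_pow_left₀ (integral_Iic_nonneg hw0 r) (monotone_integral_Iic hw hw0 hr) n

/-- With `g` the primitive of `w`, the integrand is `(g^(n+1))' / (n+1)` almost everywhere. As `w`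
is only integrable, the fundamental theorem is used for absolutely continuous functions, on `[a, x]`
first and then with `a → -∞`. This is the source of the `1/n!` in the Neumann series. -/
lemma integral_Iic_pow_mul_le {w : ℝ → ℝ} (hw : ∀ a, IntegrableOn w (Iic a))
    (hw0 : ∀ r, 0 ≤ w r) (n : ℕ) (x : ℝ) :
    ∫ r in Iic x, (∫ s in Iic r, w s) ^ n * w r ≤ (∫ s in Iic x, w s) ^ (n + 1) / (n + 1) := by
  set g : ℝ → ℝ := fun x => ∫ s in Iic x, w s with hg
  have key : ∀ a ≤ x, ∫ r in a..x, g r ^ n * w r ≤ g x ^ (n + 1) / (n + 1) := by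
    intro a hax
    have hac : ∀ m : ℕ, AbsolutelyContinuousOnInterval (fun r => g r ^ (m + 1)) a x := by
      intro m
      induction m with
      | zero => simpa using absolutelyContinuous_integral_Iic hw a x
      | succ m ih => simpa [pow_succ] using! ih.mul (absolutelyContinuous_integral_Iic hw a x)
    have h1 := (hac n).integral_deriv_eq_sub
    have h2 : ∫ r in a..x, deriv (fun r => g r ^ (n + 1)) r
        = ∫ r in a..x, (n + 1 : ℝ) * (g r ^ n * w r) := by
      refine intervalIntegral.integral_congr_ae ?_
      filter_upwards [ae_hasDerivAt_integral_Iic hw] with r hr _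
      rw [(HasDerivAt.fun_pow hr (n + 1)).deriv]
      push_cast
      simp only [hg]
      ring
    rw [h2, intervalIntegral.integral_const_mul] at h1
    rw [le_div_iff₀ (by positivity), mul_comm, h1]
    linarith [pow_nonneg (integral_Iic_nonneg hw0 a) (n + 1)]
  refine le_of_tendsto (intervalIntegral_tendsto_integral_Iic x
    (integrableOn_mul_pow_integral_Iic hw hw0 n x) tendsto_id) ?_
  filter_upwards [eventually_le_atBot x] with a ha using key a ha

lemma tendsto_integral_Iic_atBot {w : ℝ → ℝ} (hw : ∀ a, IntegrableOn w (Iic a)) :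
    Tendsto (fun x => ∫ r in Iic x, w r) atBot (𝓝 0) := by
  have h := (intervalIntegral_tendsto_integral_Iic 0 (hw 0) tendsto_id).const_sub
    (∫ r in Iic 0, w r)
  rw [sub_self] at h
  refine h.congr fun a => ?_
  rw [setIntegral_Iic_eq_add hw a 0]; simp

variable {E : Type*} [NormedAddCommGroup E] [NormedSpace ℂ E]

lemma aestronglyMeasurable_clm_apply {W : ℝ → E →L[ℂ] E} {f : ℝ → E} {μ : Measure ℝ}
    (hW : AEStronglyMeasurable W μ) (hf : AEStronglyMeasurable f μ) :
    AEStronglyMeasurable (fun r => W r (f r)) μ :=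
  (ContinuousLinearMap.id ℂ (E →L[ℂ] E)).aestronglyMeasurable_comp₂ hW hf

lemma integrableOn_clm_apply {W : ℝ → E →L[ℂ] E} {f : ℝ → E} {x C : ℝ}
    (hW : IntegrableOn W (Iic x)) (hf : Continuous f) (hC : ∀ r ≤ x, ‖f r‖ ≤ C) :
    IntegrableOn (fun r => W r (f r)) (Iic x) := by
  refine (hW.norm.const_mul C).mono'
    (aestronglyMeasurable_clm_apply hW.1 hf.aestronglyMeasurable) ?_
  filter_upwards [ae_restrict_mem measurableSet_Iic] with r hr
  refine ((W r).le_opNorm _).trans ?_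
  rw [mul_comm]
  exact mul_le_mul_of_nonneg_right (hC r hr) (norm_nonneg _)

lemma integrableOn_conv {k : ℝ → E →L[ℂ] E} {h : ℝ → E} {x B : ℝ} (hk : Continuous k)
    (hB : ∀ s, 0 ≤ s → ‖k s‖ ≤ B) (hh : IntegrableOn h (Iic x)) :
    IntegrableOn (fun r => k (x - r) (h r)) (Iic x) := by
  refine (hh.norm.const_mul B).mono' (aestronglyMeasurable_clm_apply
    (hk.comp (continuous_const.sub continuous_id)).aestronglyMeasurable hh.1) ?_
  filter_upwards [ae_restrict_mem measurableSet_Iic] with r hr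
  exact (k (x - r)).le_of_opNorm_le (hB _ (sub_nonneg.2 hr)) _

lemma continuous_conv {k : ℝ → E →L[ℂ] E} {h : ℝ → E} {B : ℝ} (hk : Continuous k)
    (hB : ∀ s, 0 ≤ s → ‖k s‖ ≤ B) (hh : ∀ a, IntegrableOn h (Iic a)) :
    Continuous fun x => ∫ r in Iic x, k (x - r) (h r) := by
  refine continuous_iff_continuousAt.2 fun x₀ => ?_
  simp_rw [← integral_indicator (measurableSet_Iic (α := ℝ))]
  refine continuousAt_of_dominated (bound := (Iic (x₀ + 1)).indicator fun r => B * ‖h r‖) ?_ ?_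
    ((integrable_indicator_iff measurableSet_Iic).2 ((hh _).norm.const_mul B)) ?_
  · exact Eventually.of_forall fun x =>
      (aestronglyMeasurable_indicator_iff measurableSet_Iic).2 (integrableOn_conv hk hB (hh x)).1
  · filter_upwards [Iic_mem_nhds (lt_add_one x₀)] with x hx
    refine Eventually.of_forall fun r => ?_
    by_cases hr : r ≤ x
    · rw [indicator_of_mem (show r ∈ Iic x from hr),
        indicator_of_mem (show r ∈ Iic (x₀ + 1) from hr.trans hx)]
      exact (k (x - r)).le_of_opNorm_le (hB _ (sub_nonneg.2 hr)) _
    · rw [indicator_of_notMem (by simpa using hr), norm_zero]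
      refine indicator_nonneg (fun r _ => mul_nonneg ((norm_nonneg _).trans (hB 0 le_rfl))
        (norm_nonneg _)) _
  -- For fixed `r`, the cut-off `r ≤ x` is locally constant in `x` near `x₀` unless `r = x₀`, a null
  -- set.
  · filter_upwards [Measure.ae_ne volume x₀] with r hr
    have hc : Continuous fun x => k (x - r) (h r) :=
      (hk.comp (continuous_id.sub continuous_const)).clm_apply continuous_const
    rcases lt_or_gt_of_ne hr with hlt | hgt
    · refine hc.continuousAt.congr ?_
      filter_upwards [Ioi_mem_nhds hlt] with x hx
      rw [indicator_of_mem (show r ∈ Iic x from (mem_Ioi.1 hx).le)]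
    · refine (continuousAt_const (y := (0 : E))).congr ?_
      filter_upwards [Iio_mem_nhds hgt] with x hx
      rw [indicator_of_notMem (show r ∉ Iic x from not_le.2 (mem_Iio.1 hx))]

/-- One Volterra step raises the power of `∫ ‖W‖` by one and costs a factor `B`; the new factorial
comes from `integral_Iic_pow_mul_le`. The same estimate drives existence, uniqueness and the limit
at `-∞`. -/
lemma norm_conv_le {k W : ℝ → E →L[ℂ] E} {f : ℝ → E} {B C x : ℝ} (n : ℕ)
    (hB : ∀ s, 0 ≤ s → ‖k s‖ ≤ B) (hW : ∀ a, IntegrableOn W (Iic a))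
    (hf : ∀ r ≤ x, ‖f r‖ ≤ C * ((∫ s in Iic r, ‖W s‖) ^ n / n.factorial)) :
    ‖∫ r in Iic x, k (x - r) (W r (f r))‖
      ≤ B * C * ((∫ s in Iic x, ‖W s‖) ^ (n + 1) / (n + 1).factorial) := by
  have hW' : ∀ a, IntegrableOn (fun r => ‖W r‖) (Iic a) := fun a => (hW a).norm
  have hB0 : 0 ≤ B := (norm_nonneg _).trans (hB 0 le_rfl)
  have hint := (integrableOn_mul_pow_integral_Iic hW' (fun r => norm_nonneg _) n x).const_mul
    (B * C / n.factorial)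
  have hle := integral_Iic_pow_mul_le hW' (fun r => norm_nonneg _) n x
  by_cases hC : 0 ≤ C
  · calc ‖∫ r in Iic x, k (x - r) (W r (f r))‖
        ≤ ∫ r in Iic x, B * C / n.factorial * ((∫ s in Iic r, ‖W s‖) ^ n * ‖W r‖) := by
          refine norm_integral_le_of_norm_le hint ?_
          filter_upwards [ae_restrict_mem measurableSet_Iic] with r hr
          refine ((k (x - r)).le_of_opNorm_le (hB _ (sub_nonneg.2 hr)) _).trans ?_
          calc B * ‖W r (f r)‖ ≤ B * (‖W r‖ * (C * ((∫ s in Iic r, ‖W s‖) ^ n / n.factorial))) := by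
                gcongr
                exact ((W r).le_opNorm _).trans (by gcongr; exact hf r hr)
            _ = _ := by ring
      _ ≤ B * C / n.factorial * ((∫ s in Iic x, ‖W s‖) ^ (n + 1) / (n + 1)) := by
          rw [integral_const_mul]; gcongr
      _ = _ := by rw [Nat.factorial_succ]; push_cast; field_simp
  -- For `C < 0` the bound forces `f = 0`, and at `r = x` it also forces the right-hand side to
  -- vanish, so it is not negative.
  · have hz : ∀ r ≤ x, f r = 0 := by
      intro r hr
      have h1 : C * ((∫ s in Iic r, ‖W s‖) ^ n / n.factorial) ≤ 0 :=
        mul_nonpos_of_nonpos_of_nonneg (le_of_not_ge hC)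
          (by have := integral_Iic_nonneg (fun r => norm_nonneg (W r)) r; positivity)
      exact norm_le_zero_iff.1 ((hf r hr).trans h1)
    have h0 : (∫ s in Iic x, ‖W s‖) ^ n * C = 0 := by
      have h1 := (norm_nonneg _).trans (hf x le_rfl)
      have h2 := integral_Iic_nonneg (fun r => norm_nonneg (W r)) x
      have h3 : C * ((∫ s in Iic x, ‖W s‖) ^ n / n.factorial) = 0 :=
        le_antisymm (mul_nonpos_of_nonpos_of_nonneg (le_of_not_ge hC) (by positivity)) h1
      have h4 : (n.factorial : ℝ) ≠ 0 := by positivity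
      field_simp at h3
      linarith
    rw [setIntegral_congr_fun (g := fun _ => (0 : E)) measurableSet_Iic
      fun r hr => by simp [hz r hr]]
    rw [pow_succ, integral_zero, norm_zero]
    exact le_of_eq (by linear_combination (-B * (∫ s in Iic x, ‖W s‖) / (n + 1).factorial) * h0)

/-- The Neumann iterates of `m x = y + ∫_{-∞}^x k (x - r) W(r) m(r) dr`. -/
def volterraIter (k W : ℝ → E →L[ℂ] E) (y : E) : ℕ → ℝ → E
  | 0 => fun _ => y
  | n + 1 => fun x => ∫ r in Iic x, k (x - r) (W r (volterraIter k W y n r))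

/-- The Neumann series solution of `m x = y + ∫_{-∞}^x k (x - r) W(r) m(r) dr`. -/
def volterraSol (k W : ℝ → E →L[ℂ] E) (y : E) (x : ℝ) : E := ∑' n, volterraIter k W y n x

variable {k W : ℝ → E →L[ℂ] E} {B : ℝ}

lemma volterraIter_spec (hk : Continuous k) (hB : ∀ s, 0 ≤ s → ‖k s‖ ≤ B)
    (hW : ∀ a, IntegrableOn W (Iic a)) (y : E) (n : ℕ) :
    Continuous (volterraIter k W y n) ∧
    ∀ x, ‖volterraIter k W y n x‖ ≤ ‖y‖ * B ^ n * ((∫ s in Iic x, ‖W s‖) ^ n / n.factorial) := by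
  have hB0 : 0 ≤ B := (norm_nonneg _).trans (hB 0 le_rfl)
  induction n with
  | zero => exact ⟨continuous_const, fun x => by simp [volterraIter]⟩
  | succ n ih =>
    refine ⟨continuous_conv hk hB fun a => integrableOn_clm_apply (hW a) ih.1
      (C := ‖y‖ * B ^ n * ((∫ s in Iic a, ‖W s‖) ^ n / n.factorial)) fun r hr =>
        (ih.2 r).trans ?_, fun x => (norm_conv_le n hB hW fun r _ => ih.2 r).trans_eq (by ring)⟩
    have h1 := integral_Iic_nonneg (fun r => norm_nonneg (W r)) r
    have h2 := monotone_integral_Iic (fun a => (hW a).norm) (fun r => norm_nonneg _) hr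
    gcongr

lemma summable_volterra_bound (c B g : ℝ) :
    Summable fun n : ℕ => c * B ^ n * (g ^ n / n.factorial) := by
  refine ((Real.summable_pow_div_factorial (B * g)).mul_left c).congr fun n => ?_
  rw [mul_pow]; ring

lemma tsum_volterra_bound (c B g : ℝ) :
    ∑' n : ℕ, c * B ^ n * (g ^ n / n.factorial) = c * Real.exp (B * g) := by
  rw [Real.exp_eq_exp_ℝ, NormedSpace.exp_eq_tsum_div, ← tsum_mul_left]
  refine tsum_congr fun n => ?_
  rw [mul_pow]; ring

lemma volterraIter_le (hk : Continuous k) (hB : ∀ s, 0 ≤ s → ‖k s‖ ≤ B)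
    (hW : ∀ a, IntegrableOn W (Iic a)) (y : E) (n : ℕ) {r x : ℝ} (hr : r ≤ x) :
    ‖volterraIter k W y n r‖ ≤ ‖y‖ * B ^ n * ((∫ s in Iic x, ‖W s‖) ^ n / n.factorial) := by
  refine ((volterraIter_spec hk hB hW y n).2 r).trans ?_
  have hB0 : 0 ≤ B := (norm_nonneg _).trans (hB 0 le_rfl)
  have h1 := integral_Iic_nonneg (fun r => norm_nonneg (W r)) r
  have h2 := monotone_integral_Iic (fun a => (hW a).norm) (fun r => norm_nonneg _) hr
  gcongr

lemma hasSum_volterraSol [CompleteSpace E] (hk : Continuous k) (hB : ∀ s, 0 ≤ s → ‖k s‖ ≤ B)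
    (hW : ∀ a, IntegrableOn W (Iic a)) (y : E) (x : ℝ) :
    HasSum (fun n => volterraIter k W y n x) (volterraSol k W y x) :=
  (Summable.of_norm_bounded (summable_volterra_bound _ _ _)
    (volterraIter_spec hk hB hW y · |>.2 x)).hasSum

lemma norm_volterraSol_le [CompleteSpace E] (hk : Continuous k) (hB : ∀ s, 0 ≤ s → ‖k s‖ ≤ B)
    (hW : ∀ a, IntegrableOn W (Iic a)) (y : E) {r x : ℝ} (hr : r ≤ x) :
    ‖volterraSol k W y r‖ ≤ ‖y‖ * Real.exp (B * ∫ s in Iic x, ‖W s‖) := by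
  rw [← tsum_volterra_bound]
  exact tsum_of_norm_bounded (summable_volterra_bound _ _ _).hasSum
    fun n => volterraIter_le hk hB hW y n hr

lemma continuous_volterraSol [CompleteSpace E] (hk : Continuous k) (hB : ∀ s, 0 ≤ s → ‖k s‖ ≤ B)
    (hW : ∀ a, IntegrableOn W (Iic a)) (y : E) : Continuous (volterraSol k W y) := by
  refine continuous_iff_continuousAt.2 fun x => ContinuousOn.continuousAt (s := Iic (x + 1)) ?_
    (Iic_mem_nhds (by linarith))
  exact continuousOn_tsum (fun n => (volterraIter_spec hk hB hW y n).1.continuousOn)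
    (summable_volterra_bound _ _ _) fun n r hr => volterraIter_le hk hB hW y n hr

lemma volterraSol_eq [CompleteSpace E] (hk : Continuous k) (hB : ∀ s, 0 ≤ s → ‖k s‖ ≤ B)
    (hW : ∀ a, IntegrableOn W (Iic a)) (y : E) (x : ℝ) :
    volterraSol k W y x = y + ∫ r in Iic x, k (x - r) (W r (volterraSol k W y r)) := by
  have h1 : HasSum (fun n => ∫ r in Iic x, k (x - r) (W r (volterraIter k W y n r)))
      (∫ r in Iic x, k (x - r) (W r (volterraSol k W y r))) := by
    refine hasSum_integral_of_dominated_convergence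
      (fun n r => (‖y‖ * B ^ n * ((∫ s in Iic x, ‖W s‖) ^ n / n.factorial)) * (B * ‖W r‖))
      (fun n => ?_) (fun n => ?_) ?_ ?_ ?_
    · exact (integrableOn_conv hk hB (integrableOn_clm_apply (hW x)
        (volterraIter_spec hk hB hW y n).1 fun r hr => volterraIter_le hk hB hW y n hr)).1
    · filter_upwards [ae_restrict_mem measurableSet_Iic] with r hr
      have hB0 : 0 ≤ B := (norm_nonneg _).trans (hB 0 le_rfl)
      refine ((k (x - r)).le_of_opNorm_le (hB _ (sub_nonneg.2 hr)) _).trans ?_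
      refine (mul_le_mul_of_nonneg_left (((W r).le_opNorm _).trans (mul_le_mul_of_nonneg_left
        (volterraIter_le hk hB hW y n hr) (norm_nonneg _))) hB0).trans_eq (by ring)
    · exact Eventually.of_forall fun r => (summable_volterra_bound _ _ _).mul_right _
    · simp_rw [tsum_mul_right]
      exact ((hW x).norm.const_mul B).const_mul _
    · filter_upwards with r
      exact (k (x - r)).hasSum ((W r).hasSum (hasSum_volterraSol hk hB hW y r))
  -- Integrating the series term by term shifts the iterates by one; the missing zeroth term is `y`.
  have h2 : HasSum (fun n => volterraIter k W y n x)
      ((∫ r in Iic x, k (x - r) (W r (volterraSol k W y r))) +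
        ∑ n ∈ Finset.range 1, volterraIter k W y n x) :=
    (hasSum_nat_add_iff (f := fun n => volterraIter k W y n x) 1).1 h1
  rw [(hasSum_volterraSol hk hB hW y x).unique h2, Finset.sum_range_one, add_comm]
  rfl

/-- Uniqueness of bounded continuous solutions. -/
lemma volterra_unique (hk : Continuous k) (hB : ∀ s, 0 ≤ s → ‖k s‖ ≤ B)
    (hW : ∀ a, IntegrableOn W (Iic a)) {y : E} {m₁ m₂ : ℝ → E} (hc₁ : Continuous m₁)
    (hc₂ : Continuous m₂) (hb₁ : ∀ x, ∃ C, ∀ r ≤ x, ‖m₁ r‖ ≤ C)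
    (hb₂ : ∀ x, ∃ C, ∀ r ≤ x, ‖m₂ r‖ ≤ C)
    (h₁ : ∀ x, m₁ x = y + ∫ r in Iic x, k (x - r) (W r (m₁ r)))
    (h₂ : ∀ x, m₂ x = y + ∫ r in Iic x, k (x - r) (W r (m₂ r))) : m₁ = m₂ := by
  funext x
  obtain ⟨C₁, hC₁⟩ := hb₁ x
  obtain ⟨C₂, hC₂⟩ := hb₂ x
  set d : ℝ → E := fun r => m₁ r - m₂ r with hd
  have hdeq : ∀ r ≤ x, d r = ∫ s in Iic r, k (r - s) (W s (d s)) := by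
    intro r hr
    simp only [hd, map_sub]
    rw [integral_sub, h₁ r, h₂ r]
    · abel
    · exact integrableOn_conv hk hB (integrableOn_clm_apply (hW r) hc₁
        fun s hs => hC₁ s (hs.trans hr))
    · exact integrableOn_conv hk hB (integrableOn_clm_apply (hW r) hc₂
        fun s hs => hC₂ s (hs.trans hr))
  -- The difference solves the homogeneous equation, so its bound can be fed back into the equation
  -- any number of times; the factorial sends it to zero.
  have hbound : ∀ n : ℕ, ∀ r ≤ x,
      ‖d r‖ ≤ (C₁ + C₂) * B ^ n * ((∫ s in Iic r, ‖W s‖) ^ n / n.factorial) := by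
    intro n
    induction n with
    | zero =>
      intro r hr
      simpa using (norm_sub_le _ _).trans (add_le_add (hC₁ r hr) (hC₂ r hr))
    | succ n ih =>
      intro r hr
      rw [hdeq r hr]
      exact (norm_conv_le n hB hW fun s hs => ih s (hs.trans hr)).trans_eq (by ring)
  have hz : ‖d x‖ ≤ 0 := ge_of_tendsto'
    (summable_volterra_bound (C₁ + C₂) B (∫ s in Iic x, ‖W s‖)).tendsto_atTop_zero
    fun n => hbound n x le_rfl
  exact sub_eq_zero.1 (norm_le_zero_iff.1 hz)

lemma tendsto_volterra_atBot (hB : ∀ s, 0 ≤ s → ‖k s‖ ≤ B)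
    (hW : ∀ a, IntegrableOn W (Iic a)) {y : E} {m : ℝ → E} {C x₀ : ℝ}
    (hC : ∀ r ≤ x₀, ‖m r‖ ≤ C)
    (hm : ∀ x, m x = y + ∫ r in Iic x, k (x - r) (W r (m r))) : Tendsto m atBot (𝓝 y) := by
  rw [tendsto_iff_norm_sub_tendsto_zero]
  have h0 : Tendsto (fun x => B * C * ∫ s in Iic x, ‖W s‖) atBot (𝓝 0) := by
    simpa using (tendsto_integral_Iic_atBot fun a => (hW a).norm).const_mul (B * C)
  refine squeeze_zero' (Eventually.of_forall fun _ => norm_nonneg _) ?_ h0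
  filter_upwards [eventually_le_atBot x₀] with x hx
  rw [hm x, add_sub_cancel_left]
  simpa using norm_conv_le (C := C) 0 hB hW (fun r hr => by simpa using hC r (hr.trans hx))

lemma volterraIter_smul (k W : ℝ → E →L[ℂ] E) (c : ℂ) (y : E) (n : ℕ) (x : ℝ) :
    volterraIter k W (c • y) n x = c • volterraIter k W y n x := by
  induction n generalizing x with
  | zero => rfl
  | succ n ih => simp only [volterraIter, ih, map_smul, integral_smul]

/-- Homogeneity in the normalization; the symmetry `z ↦ -q₀²/z` matches columns only up to a scalar.
-/
lemma volterraSol_smul (k W : ℝ → E →L[ℂ] E) (c : ℂ) (y : E) (x : ℝ) :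
    volterraSol k W (c • y) x = c • volterraSol k W y x := by
  simp only [volterraSol, volterraIter_smul, tsum_const_smul'']

end Volterra

/-! ### Dependence of the Neumann series on the spectral parameter -/

section VolterraParameter

variable {E : Type*} [NormedAddCommGroup E] [NormedSpace ℂ E]

/-- A dominated integral of functions that are holomorphic in a parameter is holomorphic. -/
lemma differentiableOn_integral_of_dominated [CompleteSpace E] {F : ℂ → ℝ → E} {D : Set ℂ}
    (hD : IsOpen D)
    {μ : Measure ℝ} {bound : ℝ → ℝ} (hmeas : ∀ z ∈ D, AEStronglyMeasurable (F z) μ)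
    (hb : ∀ᵐ r ∂μ, ∀ z ∈ D, ‖F z r‖ ≤ bound r) (hbi : Integrable bound μ)
    (hd : ∀ᵐ r ∂μ, DifferentiableOn ℂ (fun z => F z r) D) :
    DifferentiableOn ℂ (fun z => ∫ r, F z r ∂μ) D := by
  intro z₀ hz₀
  obtain ⟨ε, hε, hball⟩ := Metric.isOpen_iff.1 hD z₀ hz₀
  have hsub : Metric.ball z₀ (ε / 2) ⊆ D :=
    (Metric.ball_subset_ball (by linarith)).trans hball
  -- Circles of radius `ε / 4` about points of the ball of radius `ε / 2` stay inside the ball of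
  -- radius `ε`, so Cauchy's estimate bounds the derivative by `bound / (ε / 4)`.
  have key := hasDerivAt_integral_of_dominated_loc_of_deriv_le (μ := μ) (F := F) (x₀ := z₀)
    (s := Metric.ball z₀ (ε / 2)) (F' := fun z r => deriv (fun w => F w r) z)
    (bound := fun r => bound r / (ε / 4)) (Metric.ball_mem_nhds z₀ (by positivity)) ?_ ?_ ?_ ?_ ?_ ?_
  · exact key.2.differentiableAt.differentiableWithinAt
  · filter_upwards [hD.mem_nhds hz₀] with z hz using hmeas z hz
  · exact hbi.mono' (hmeas z₀ hz₀) (hb.mono fun r hr => hr z₀ hz₀)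
  -- Measurability of the derivative in `r`: it is the limit of difference quotients along a
  -- sequence of increments.
  · have hmem : ∀ n : ℕ, z₀ + ((ε / 2 / (n + 1) : ℝ) : ℂ) ∈ D := by
      intro n
      refine hball ?_
      rw [mem_ball_iff_norm, add_sub_cancel_left, Complex.norm_real,
        Real.norm_of_nonneg (by positivity)]
      calc ε / 2 / (n + 1) ≤ ε / 2 := div_le_self (by positivity) (by linarith [n.cast_nonneg (α := ℝ)])
        _ < ε := by linarith
    refine aestronglyMeasurable_of_tendsto_ae atTop
      (f := fun (n : ℕ) r => ((ε / 2 / (n + 1) : ℝ) : ℂ)⁻¹ •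
        (F (z₀ + ((ε / 2 / (n + 1) : ℝ) : ℂ)) r - F z₀ r))
      (fun n => ((hmeas _ (hmem n)).sub (hmeas _ hz₀)).const_smul _) ?_
    filter_upwards [hd] with r hr
    have h1 := ((hr z₀ hz₀).differentiableAt (hD.mem_nhds hz₀)).hasDerivAt.tendsto_slope_zero
    refine h1.comp (tendsto_nhdsWithin_iff.2 ⟨?_, ?_⟩)
    · have h2 : Tendsto (fun n : ℕ => ε / 2 / ((n : ℝ) + 1)) atTop (𝓝 0) := by
        simpa [div_eq_mul_inv] using (tendsto_one_div_add_atTop_nhds_zero_nat (𝕜 := ℝ)).const_mul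
          (ε / 2)
      exact_mod_cast (Complex.continuous_ofReal.tendsto 0).comp h2
    · refine Eventually.of_forall fun n => ?_
      rw [mem_compl_singleton_iff, Complex.ofReal_ne_zero]
      positivity
  · filter_upwards [hb, hd] with r hr hdr z hz
    refine Complex.norm_deriv_le_of_forall_mem_sphere_norm_le (by positivity)
      (DifferentiableOn.diffContOnCl ?_) fun w hw => hr w ?_
    · refine hdr.mono (Metric.closure_ball_subset_closedBall.trans fun w hw => hball ?_)
      rw [Metric.mem_ball] at hz ⊢
      rw [Metric.mem_closedBall] at hw
      linarith [dist_triangle w z z₀]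
    · refine hball ?_
      rw [Metric.mem_ball] at hz ⊢
      rw [Metric.mem_sphere] at hw
      linarith [dist_triangle w z z₀]
  · exact hbi.div_const _
  · filter_upwards [hd] with r hr z hz
    exact ((hr z (hsub hz)).differentiableAt (hD.mem_nhds (hsub hz))).hasDerivAt

variable {k : ℂ → ℝ → E →L[ℂ] E} {W : ℝ → E →L[ℂ] E} {y : ℂ → E} {N : Set ℂ} {B C : ℝ}

lemma volterraIter_le_of_le (hk : ∀ z ∈ N, Continuous (k z))
    (hB : ∀ z ∈ N, ∀ s, 0 ≤ s → ‖k z s‖ ≤ B) (hW : ∀ a, IntegrableOn W (Iic a))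
    (hC : ∀ z ∈ N, ‖y z‖ ≤ C) (n : ℕ) {r x : ℝ} (hr : r ≤ x) {z : ℂ} (hz : z ∈ N) :
    ‖volterraIter (k z) W (y z) n r‖ ≤ C * B ^ n * ((∫ s in Iic x, ‖W s‖) ^ n / n.factorial) := by
  refine (volterraIter_le (hk z hz) (hB z hz) hW (y z) n hr).trans ?_
  have hB0 : 0 ≤ B := (norm_nonneg _).trans (hB z hz 0 le_rfl)
  have h1 := integral_Iic_nonneg (fun r => norm_nonneg (W r)) x
  gcongr
  exact hC z hz

lemma volterra_integrand_meas (hk : ∀ z ∈ N, Continuous (k z))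
    (hB : ∀ z ∈ N, ∀ s, 0 ≤ s → ‖k z s‖ ≤ B) (hW : ∀ a, IntegrableOn W (Iic a)) (n : ℕ) (x : ℝ)
    {z : ℂ} (hz : z ∈ N) : AEStronglyMeasurable
      (fun r => k z (x - r) (W r (volterraIter (k z) W (y z) n r))) (volume.restrict (Iic x)) :=
  (integrableOn_conv (hk z hz) (hB z hz) (integrableOn_clm_apply (hW x)
    (volterraIter_spec (hk z hz) (hB z hz) hW (y z) n).1
      fun _ hr => volterraIter_le (hk z hz) (hB z hz) hW (y z) n hr)).1

lemma volterra_integrand_le (hk : ∀ z ∈ N, Continuous (k z))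
    (hB : ∀ z ∈ N, ∀ s, 0 ≤ s → ‖k z s‖ ≤ B) (hW : ∀ a, IntegrableOn W (Iic a))
    (hC : ∀ z ∈ N, ‖y z‖ ≤ C) (n : ℕ) {r x : ℝ} (hr : r ≤ x) {z : ℂ} (hz : z ∈ N) :
    ‖k z (x - r) (W r (volterraIter (k z) W (y z) n r))‖ ≤
      C * B ^ n * ((∫ s in Iic x, ‖W s‖) ^ n / n.factorial) * (B * ‖W r‖) := by
  have hB0 : 0 ≤ B := (norm_nonneg _).trans (hB z hz 0 le_rfl)
  refine ((k z (x - r)).le_of_opNorm_le (hB z hz _ (sub_nonneg.2 hr)) _).trans ?_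
  exact (mul_le_mul_of_nonneg_left (((W r).le_opNorm _).trans (mul_le_mul_of_nonneg_left
    (volterraIter_le_of_le hk hB hW hC n hr hz) (norm_nonneg _))) hB0).trans_eq (by ring)

lemma continuousOn_volterraSol_of_le [CompleteSpace E] (hk : ∀ z ∈ N, Continuous (k z))
    (hB : ∀ z ∈ N, ∀ s, 0 ≤ s → ‖k z s‖ ≤ B) (hW : ∀ a, IntegrableOn W (Iic a))
    (hC : ∀ z ∈ N, ‖y z‖ ≤ C) (hkz : ∀ s, ContinuousOn (fun z => k z s) N)
    (hy : ContinuousOn y N) (x : ℝ) :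
    ContinuousOn (fun z => volterraSol (k z) W (y z) x) N := by
  refine continuousOn_tsum (fun n => ?_) (summable_volterra_bound C B (∫ s in Iic x, ‖W s‖))
    fun n z hz => volterraIter_le_of_le hk hB hW hC n le_rfl hz
  induction n generalizing x with
  | zero => exact hy
  | succ n ih =>
    refine continuousOn_of_dominated
      (bound := fun r => C * B ^ n * ((∫ s in Iic x, ‖W s‖) ^ n / n.factorial) * (B * ‖W r‖))
      (fun z hz => volterra_integrand_meas hk hB hW n x hz) (fun z hz => ?_)
      (((hW x).norm.const_mul B).const_mul _) ?_
    · filter_upwards [ae_restrict_mem measurableSet_Iic] with r hr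
      exact volterra_integrand_le hk hB hW hC n hr hz
    · exact Eventually.of_forall fun r =>
        (hkz _).clm_apply ((W r).continuous.comp_continuousOn (ih r))

lemma differentiableOn_volterraSol_of_le [CompleteSpace E] (hN : IsOpen N)
    (hk : ∀ z ∈ N, Continuous (k z))
    (hB : ∀ z ∈ N, ∀ s, 0 ≤ s → ‖k z s‖ ≤ B) (hW : ∀ a, IntegrableOn W (Iic a))
    (hC : ∀ z ∈ N, ‖y z‖ ≤ C) (hkz : ∀ s, DifferentiableOn ℂ (fun z => k z s) N)
    (hy : DifferentiableOn ℂ y N) (x : ℝ) :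
    DifferentiableOn ℂ (fun z => volterraSol (k z) W (y z) x) N := by
  refine Complex.differentiableOn_tsum_of_summable_norm
    (summable_volterra_bound C B (∫ s in Iic x, ‖W s‖)) (fun n => ?_) hN
    fun n z hz => volterraIter_le_of_le hk hB hW hC n le_rfl hz
  induction n generalizing x with
  | zero => exact hy
  | succ n ih =>
    refine differentiableOn_integral_of_dominated hN
      (bound := fun r => C * B ^ n * ((∫ s in Iic x, ‖W s‖) ^ n / n.factorial) * (B * ‖W r‖))
      (fun z hz => volterra_integrand_meas hk hB hW n x hz) ?_
      (((hW x).norm.const_mul B).const_mul _) ?_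
    · filter_upwards [ae_restrict_mem measurableSet_Iic] with r hr z hz
      exact volterra_integrand_le hk hB hW hC n hr hz
    · exact Eventually.of_forall fun r =>
        (hkz _).clm_apply ((W r).differentiable.comp_differentiableOn (ih r))

/-- Continuous and analytic dependence of the Neumann series on a parameter, under bounds on the
kernel that are locally uniform in the parameter. -/
lemma volterraSol_parameter [CompleteSpace E] {S D : Set ℂ} (hD : IsOpen D) (hDS : D ⊆ S)
    (hk : ∀ z ∈ S, Continuous (k z))
    (hB : ∀ z₀ ∈ S, ∃ U ∈ 𝓝 z₀, ∃ B, ∀ z ∈ U ∩ S, ∀ s, 0 ≤ s → ‖k z s‖ ≤ B)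
    (hW : ∀ a, IntegrableOn W (Iic a)) (hkc : ∀ s, ContinuousOn (fun z => k z s) S)
    (hkd : ∀ s, DifferentiableOn ℂ (fun z => k z s) D) (hyc : ContinuousOn y S)
    (hyd : DifferentiableOn ℂ y D) (x : ℝ) :
    ContinuousOn (fun z => volterraSol (k z) W (y z) x) S ∧
    DifferentiableOn ℂ (fun z => volterraSol (k z) W (y z) x) D := by
  have hloc : ∀ z₀ ∈ S, ∃ V, IsOpen V ∧ z₀ ∈ V ∧ ∃ B C, (∀ z ∈ V ∩ S, ‖y z‖ ≤ C) ∧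
      ∀ z ∈ V ∩ S, ∀ s, 0 ≤ s → ‖k z s‖ ≤ B := by
    intro z₀ hz₀
    obtain ⟨U, hU, B, hUB⟩ := hB z₀ hz₀
    have h1 : ∀ᶠ z in 𝓝[S] z₀, ‖y z‖ ≤ ‖y z₀‖ + 1 :=
      ((hyc z₀ hz₀).norm.eventually (gt_mem_nhds (lt_add_one _))).mono fun _ h => le_of_lt h
    obtain ⟨U', hU', hU'S⟩ := mem_nhdsWithin_iff_exists_mem_nhds_inter.1 h1
    obtain ⟨V, hVU, hVo, hzV⟩ := mem_nhds_iff.1 (inter_mem hU hU')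
    exact ⟨V, hVo, hzV, B, _, fun z hz => hU'S ⟨(hVU hz.1).2, hz.2⟩,
      fun z hz => hUB z ⟨(hVU hz.1).1, hz.2⟩⟩
  refine ⟨fun z₀ hz₀ => ?_, fun z₀ hz₀ => ?_⟩
  · obtain ⟨V, hVo, hzV, B, C, hC, hB'⟩ := hloc z₀ hz₀
    refine (continuousWithinAt_inter' (mem_nhdsWithin_of_mem_nhds (hVo.mem_nhds hzV))).1 ?_
    rw [inter_comm]
    exact continuousOn_volterraSol_of_le (fun z hz => hk z hz.2) hB' hW hC
      (fun s => (hkc s).mono inter_subset_right) (hyc.mono inter_subset_right) x z₀ ⟨hzV, hz₀⟩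
  · obtain ⟨V, hVo, hzV, B, C, hC, hB'⟩ := hloc z₀ (hDS hz₀)
    have hsub : V ∩ D ⊆ V ∩ S := inter_subset_inter_right V hDS
    exact ((differentiableOn_volterraSol_of_le (hVo.inter hD) (fun z hz => hk z (hsub hz).2)
      (fun z hz => hB' z (hsub hz)) hW (fun z hz => hC z (hsub hz))
      (fun s => (hkd s).mono inter_subset_right) (hyd.mono inter_subset_right) x z₀
      ⟨hzV, hz₀⟩).differentiableAt ((hVo.inter hD).mem_nhds ⟨hzV, hz₀⟩)).differentiableWithinAt

end VolterraParameter

/-! ### Uniqueness of holomorphic functions with given real boundary values -/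

section BoundaryUniqueness

/-- If `f` is holomorphic inside a square, continuous on it and zero on its bottom edge, then it
vanishes at the centre. -/
lemma eq_zero_center_of_eq_zero_edge {f : ℂ → ℂ} {c : ℂ} {ε : ℝ} (hε : 0 < ε)
    (hd : ∀ w : ℂ, |w.re| < ε → |w.im| < ε → DifferentiableAt ℂ f (c + w))
    (hc : ContinuousOn f {z | |(z - c).re| ≤ ε ∧ |(z - c).im| ≤ ε})
    (h0 : ∀ w : ℂ, |w.re| ≤ ε → w.im = -ε → f (c + w) = 0) : f c = 0 := by
  set Q : Set ℂ := Ioo (-ε) ε ×ℂ Ioo (-ε) ε with hQ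
  have hcl : closure Q = Icc (-ε) ε ×ℂ Icc (-ε) ε := by
    rw [hQ, Complex.closure_reProdIm, closure_Ioo (by linarith)]
  have hmQ : ∀ w : ℂ, w ∈ Q ↔ |w.re| < ε ∧ |w.im| < ε := fun w => by
    rw [hQ, Complex.mem_reProdIm, mem_Ioo, mem_Ioo, abs_lt, abs_lt]
  have hmcl : ∀ w : ℂ, w ∈ closure Q ↔ |w.re| ≤ ε ∧ |w.im| ≤ ε := fun w => by
    rw [hcl, Complex.mem_reProdIm, mem_Icc, mem_Icc, abs_le, abs_le]
  have hbdd : Bornology.IsBounded Q :=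
    (Metric.isBounded_Ioo _ _).reProdIm (Metric.isBounded_Ioo _ _)
  have hopen : IsOpen Q := isOpen_Ioo.reProdIm isOpen_Ioo
  set g : ℂ → ℂ → ℂ := fun u w => f (c + u * w) with hg
  have hrot : ∀ u : ℂ, (u = 1 ∨ u = -1 ∨ u = Complex.I ∨ u = -Complex.I) →
      DiffContOnCl ℂ (g u) Q := by
    intro u hu
    refine ⟨fun w hw => ?_, fun w hw => ?_⟩
    · have hw' := (hmQ w).1 hw
      have : DifferentiableAt ℂ f (c + u * w) := by
        apply hd <;> rcases hu with rfl | rfl | rfl | rfl <;> simp [hw'.1, hw'.2]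
      exact (this.comp w (by fun_prop : DifferentiableAt ℂ (fun w => c + u * w) w)).differentiableWithinAt
    · have hmaps : MapsTo (fun w => c + u * w) (closure Q)
          {z | |(z - c).re| ≤ ε ∧ |(z - c).im| ≤ ε} := by
        intro w hw
        have hw' := (hmcl w).1 hw
        rcases hu with rfl | rfl | rfl | rfl <;> simp [hw'.1, hw'.2]
      exact hc.comp (by fun_prop : Continuous fun w => c + u * w).continuousOn hmaps w hw
  -- One of the rotations by `1`, `-1`, `i`, `-i` carries each given side of the square to the
  -- bottom edge. The product of the four rotated copies thus vanishes on the whole frontier, hence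
  -- at the centre, where it equals `f(c)⁴`.
  have hprod : DiffContOnCl ℂ
      (fun w => g 1 w * g (-1) w * (g Complex.I w * g (-Complex.I) w)) Q := by
    have h : ∀ {a b : ℂ → ℂ}, DiffContOnCl ℂ a Q → DiffContOnCl ℂ b Q →
        DiffContOnCl ℂ (fun w => a w * b w) Q := fun ha hb => ha.smul hb
    exact h (h (hrot _ (by simp)) (hrot _ (by simp))) (h (hrot _ (by simp)) (hrot _ (by simp)))
  have hfr : ∀ w ∈ frontier Q, ‖g 1 w * g (-1) w * (g Complex.I w * g (-Complex.I) w)‖ ≤ 0 := by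
    intro w hw
    rw [frontier, hopen.interior_eq] at hw
    obtain ⟨hw1, hw2⟩ := hw
    rw [hmcl] at hw1
    rw [hmQ] at hw2
    rw [norm_le_zero_iff]
    have hcases : |w.re| = ε ∨ |w.im| = ε := by
      by_contra! hcon
      exact hw2 ⟨lt_of_le_of_ne hw1.1 hcon.1, lt_of_le_of_ne hw1.2 hcon.2⟩
    rcases hcases with h | h <;> rcases (abs_eq hε.le).1 h with h' | h'
    · have : g (-Complex.I) w = 0 := h0 _ (by simpa using hw1.2) (by simp [h'])
      simp [this]
    · have : g Complex.I w = 0 := h0 _ (by simpa using hw1.2) (by simp [h'])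
      simp [this]
    · have : g (-1) w = 0 := h0 _ (by simpa using hw1.1) (by simp [h'])
      simp [this]
    · have : g 1 w = 0 := h0 _ (by simpa using hw1.1) (by simp [h'])
      simp [this]
  have h00 := Complex.norm_le_of_forall_mem_frontier_norm_le hbdd hprod hfr
    (z := 0) (subset_closure ((hmQ 0).2 (by simpa using hε)))
  have h4 : f c * f c * (f c * f c) = 0 := by
    simpa only [hg, mul_zero, add_zero] using norm_le_zero_iff.1 h00
  simpa using h4

/-- A function holomorphic on a connected open part `D` of the upper half-plane, continuous up to
real boundary points `B` and zero there, vanishes on `D`, if `D` and `B` fill up the upper half of a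
neighbourhood of some boundary point. -/
lemma eqOn_zero_of_real_boundary {f : ℂ → ℂ} {D B : Set ℂ} (hDc : IsPreconnected D) (hf : AnalyticOnNhd ℂ f D) (hc : ContinuousOn f (D ∪ B))
    (h0 : ∀ z ∈ B, f z = 0) {p ρ : ℝ} (hρ : 0 < ρ)
    (hD : ∀ z : ℂ, ‖z - p‖ < ρ → 0 < z.im → z ∈ D)
    (hB : ∀ z : ℂ, ‖z - p‖ < ρ → z.im = 0 → z ∈ B) : EqOn f 0 D := by
  -- The square centred at `c` with half-side `c.im` has its bottom edge on the real axis. The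
  -- radius `ρ / 4` keeps it in the disc: its points are within `2 * c.im < ρ / 2` of `c`.
  have hzero : ∀ c : ℂ, ‖c - p‖ < ρ / 4 → 0 < c.im → f c = 0 := by
    intro c hcp hcim
    have him : c.im < ρ / 4 := by
      have := (le_abs_self _).trans (Complex.abs_im_le_norm (c - p))
      simp at this
      linarith
    have hnear : ∀ w : ℂ, |w.re| ≤ c.im → |w.im| ≤ c.im → ‖c + w - p‖ < ρ := by
      intro w h1 h2
      calc ‖c + w - p‖ = ‖(c - p) + w‖ := by ring_nf
        _ ≤ ‖c - p‖ + (|w.re| + |w.im|) :=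
          (norm_add_le _ _).trans (by gcongr; exact Complex.norm_le_abs_re_add_abs_im w)
        _ < ρ := by linarith
    refine eq_zero_center_of_eq_zero_edge hcim (fun w h1 h2 => ?_) (hc.mono ?_) fun w h1 h2 => ?_
    · exact (hf _ (hD _ (hnear w h1.le h2.le)
        (by rw [Complex.add_im]; linarith [(abs_lt.1 h2).1]))).differentiableAt
    · rintro z ⟨h1, h2⟩
      have hn := hnear (z - c) h1 h2
      rw [add_sub_cancel] at hn
      have him : 0 ≤ z.im := by
        have := (abs_le.1 h2).1
        rw [Complex.sub_im] at this
        linarith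
      rcases him.lt_or_eq with h | h
      · exact Or.inl (hD z hn h)
      · exact Or.inr (hB z hn h.symm)
    · exact h0 _ (hB _ (hnear w h1 (by rw [h2, abs_neg, abs_of_pos hcim]))
        (by rw [Complex.add_im, h2]; ring))
  -- A point around which all nearby points are covered by `hzero`; the identity theorem then
  -- spreads the vanishing over `D`.
  set c₀ : ℂ := p + (ρ / 8 : ℝ) * Complex.I with hc₀
  have hc₀p : ‖c₀ - p‖ = ρ / 8 := by
    rw [hc₀, add_sub_cancel_left, norm_mul, Complex.norm_I, mul_one, Complex.norm_real,
      Real.norm_of_nonneg (by positivity)]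
  have hc₀im : 0 < c₀.im := by simp [hc₀, hρ]
  refine hf.eqOn_zero_of_preconnected_of_eventuallyEq_zero hDc
    (hD c₀ (by rw [hc₀p]; linarith) hc₀im) ?_
  have h1 : ∀ᶠ z : ℂ in 𝓝 c₀, ‖z - p‖ < ρ / 4 :=
    ContinuousAt.eventually_lt (by fun_prop) continuousAt_const (by rw [hc₀p]; linarith)
  have h2 : ∀ᶠ z in 𝓝 c₀, 0 < z.im := Complex.continuous_im.continuousAt.eventually
    (lt_mem_nhds hc₀im)
  filter_upwards [h1, h2] with z hz1 hz2 using hzero z hz1 hz2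

end BoundaryUniqueness

/-! ### Background eigenvectors and the column kernels -/

abbrev C3 := Fin 3 → ℂ

/-- A `3 × 3` matrix as a continuous linear map. -/
def mcl : M3 →ₐ[ℂ] (C3 →L[ℂ] C3) :=
  (Module.End.toContinuousLinearMap C3).toAlgHom.comp Matrix.toLinAlgEquiv'.toAlgHom

@[simp] lemma mcl_apply (A : M3) (v : C3) : mcl A v = A.mulVec v := rfl

lemma continuous_mcl : Continuous mcl := mcl.toLinearMap.continuous_of_finiteDimensional

open scoped Matrix.Norms.Operator in
lemma mcl_exp (A : M3) : mcl (NormedSpace.exp A) = NormedSpace.exp (mcl A) :=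
  NormedSpace.map_exp mcl continuous_mcl A

lemma norm_mcl_diagonal_le {d : Fin 3 → ℂ} (hd : ∀ i, ‖d i‖ ≤ 1) :
    ‖mcl (Matrix.diagonal d)‖ ≤ 1 := by
  refine ContinuousLinearMap.opNorm_le_bound _ zero_le_one fun v => ?_
  rw [one_mul, pi_norm_le_iff_of_nonneg (norm_nonneg _)]
  intro i
  rw [mcl_apply, Matrix.mulVec_diagonal, norm_mul]
  exact (mul_le_of_le_one_left (norm_nonneg _) (hd i)).trans (norm_le_pi_norm v i)

lemma matA_eq (k : ℂ) (q : V) : matA k q =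
    !![-(Complex.I * k), star (q 0), star (q 1);
       -(q 0), Complex.I * k, 0;
       -(q 1), 0, Complex.I * k] := by
  ext i j
  fin_cases i <;> fin_cases j <;> simp [matA, matQ, matJ]

lemma mul_star_add_mul_star {q₀ : ℝ} {q : V} (hq : ‖q‖ = q₀) :
    q 0 * star (q 0) + q 1 * star (q 1) = (q₀ : ℂ) ^ 2 := by
  rw [← hq, EuclideanSpace.norm_eq, ← Complex.ofReal_pow, Real.sq_sqrt (by positivity)]
  simp [Fin.sum_univ_two, Complex.mul_conj, Complex.normSq_eq_norm_sq]

lemma matA_mul_matY {q₀ : ℝ} {q : V} {z : ℂ} (hq : ‖q‖ = q₀) (h0 : q₀ ≠ 0) (hz : z ≠ 0) :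
    matA (specK q₀ z) q * matY q₀ q z
      = matY q₀ q z * Matrix.diagonal fun l => Complex.I * lam1 q₀ z l := by
  have hn := mul_star_add_mul_star hq
  have h0' : (q₀ : ℂ) ≠ 0 := by exact_mod_cast h0
  have hI := Complex.I_mul_I
  rw [matA_eq]
  ext i j
  rw [Matrix.mul_diagonal, Matrix.mul_apply, Fin.sum_univ_three]
  simp only [matY, lam1, specK, specLam]
  -- With conjugates, components, `q₀` and `i` as independent symbols, the claim is a rational
  -- identity modulo `i² = -1` and `‖q‖² = q₀²`.
  generalize star (q 0) = a at *
  generalize star (q 1) = b at *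
  generalize q 0 = c at *
  generalize q 1 = d at *
  generalize (q₀ : ℂ) = e at *
  generalize Complex.I = I at *
  replace hn : c * a + d * b = e ^ 2 := hn
  fin_cases i <;> fin_cases j <;> simp <;> grind

/-- For `z ≠ 0` this vanishes only at `z = ±iq₀`, the points where the diagonalization of the
background breaks down. -/
lemma det_matY {q₀ : ℝ} {q : V} {z : ℂ} (hq : ‖q‖ = q₀) (h0 : q₀ ≠ 0) (hz : z ≠ 0) :
    (matY q₀ q z).det = 1 + (q₀ : ℂ) ^ 2 / z ^ 2 := by
  have hn := mul_star_add_mul_star hq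
  have h0' : (q₀ : ℂ) ≠ 0 := by exact_mod_cast h0
  have hI := Complex.I_mul_I
  rw [Matrix.det_fin_three]
  simp only [matY]
  generalize star (q 0) = a at *
  generalize star (q 1) = b at *
  generalize q 0 = c at *
  generalize q 1 = d at *
  generalize (q₀ : ℂ) = e at *
  generalize Complex.I = I at *
  replace hn : c * a + d * b = e ^ 2 := hn
  simp
  grind

/-- `A - i Λ_j`, which generates the kernel of the Volterra equation of the `j`-th column. -/
def gen (q₀ : ℝ) (q : V) (j : Fin 3) (z : ℂ) : M3 :=
  matA (specK q₀ z) q - (Complex.I * lam1 q₀ z j) • 1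

/-- The kernel of the Volterra equation of the `j`-th column; `ε = 1` for the solution normalized
at `-∞` and `ε = -1` for the reflection of the one normalized at `+∞`. -/
def jostKernel (ε q₀ : ℝ) (q : V) (j : Fin 3) (z : ℂ) (s : ℝ) : C3 →L[ℂ] C3 :=
  NormedSpace.exp ((ε * s : ℂ) • mcl (gen q₀ q j z))

/-- The exponential form is holomorphic for every `z ≠ 0`; this diagonalized form needs `Y`
invertible but exhibits the growth in `s` and matches the integrand of the Volterra equations. -/
lemma jostKernel_eq {ε q₀ : ℝ} {q : V} {j : Fin 3} {z : ℂ} (hq : ‖q‖ = q₀) (h0 : q₀ ≠ 0)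
    (hz : z ≠ 0) (hd : 1 + (q₀ : ℂ) ^ 2 / z ^ 2 ≠ 0) (s : ℝ) :
    jostKernel ε q₀ q j z s = mcl (matY q₀ q z * (Matrix.diagonal fun l =>
      Complex.exp (Complex.I * (ε * s) * (lam1 q₀ z l - lam1 q₀ z j))) * (matY q₀ q z)⁻¹) := by
  have hu : IsUnit (matY q₀ q z) := by
    rw [Matrix.isUnit_iff_isUnit_det, det_matY hq h0 hz]; exact hd.isUnit
  have hdet := (Matrix.isUnit_iff_isUnit_det _).1 hu
  have hg : (ε * s : ℂ) • gen q₀ q j z = matY q₀ q z * (Matrix.diagonal fun l =>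
      Complex.I * (ε * s) * (lam1 q₀ z l - lam1 q₀ z j)) * (matY q₀ q z)⁻¹ := by
    have h1 : matA (specK q₀ z) q = matY q₀ q z *
        (Matrix.diagonal fun l => Complex.I * lam1 q₀ z l) * (matY q₀ q z)⁻¹ := by
      rw [← matA_mul_matY hq h0 hz, Matrix.mul_nonsing_inv_cancel_right _ _ hdet]
    have h2 : (Complex.I * lam1 q₀ z j) • (1 : M3) = matY q₀ q z *
        ((Complex.I * lam1 q₀ z j) • (1 : M3)) * (matY q₀ q z)⁻¹ := by
      rw [Matrix.mul_smul, mul_one, Matrix.smul_mul, Matrix.mul_nonsing_inv _ hdet]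
    rw [gen, h1, h2, ← sub_mul, ← mul_sub, ← Matrix.smul_mul, ← Matrix.mul_smul]
    congr 2
    rw [Matrix.smul_one_eq_diagonal, Matrix.diagonal_sub, ← Matrix.diagonal_smul]
    congr 1
    funext l
    simp only [Pi.smul_apply, smul_eq_mul]
    ring
  rw [jostKernel, ← map_smul, ← mcl_exp, hg, Matrix.exp_conj _ _ hu, Matrix.exp_diagonal]
  congr 4
  funext l
  rw [Pi.coe_exp, Complex.exp_eq_exp_ℂ]

/-- The set of `z` at which the kernel of the `j`-th column stays bounded. -/
def admissible (ε q₀ : ℝ) (j : Fin 3) : Set ℂ :=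
  {z | z ≠ 0 ∧ ∀ l, 0 ≤ ε * (lam1 q₀ z l - lam1 q₀ z j).im}

/-- The `j`-th column of the background eigenvector matrix. -/
def colY (q₀ : ℝ) (q : V) (j : Fin 3) (z : ℂ) : C3 := fun i => matY q₀ q z i j

lemma differentiableOn_specK (q₀ : ℝ) : DifferentiableOn ℂ (specK q₀) {0}ᶜ := by
  unfold specK
  refine ((differentiableOn_id.sub (DifferentiableOn.div (differentiableOn_const _)
    differentiableOn_id fun z hz => hz)).div_const _)

lemma differentiableOn_specLam (q₀ : ℝ) : DifferentiableOn ℂ (specLam q₀) {0}ᶜ := by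
  unfold specLam
  refine ((differentiableOn_id.add (DifferentiableOn.div (differentiableOn_const _)
    differentiableOn_id fun z hz => hz)).div_const _)

lemma differentiableOn_lam1 (q₀ : ℝ) (j : Fin 3) :
    DifferentiableOn ℂ (fun z => lam1 q₀ z j) {0}ᶜ := by
  fin_cases j
  · exact (differentiableOn_specLam q₀).neg
  · exact differentiableOn_specK q₀
  · exact differentiableOn_specLam q₀

lemma differentiableOn_matY (q₀ : ℝ) (q : V) (i j : Fin 3) :
    DifferentiableOn ℂ (fun z => matY q₀ q z i j) {0}ᶜ := by
  have h : ∀ c : ℂ, DifferentiableOn ℂ (fun z : ℂ => c / z) {0}ᶜ := fun c =>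
    DifferentiableOn.div (differentiableOn_const _) differentiableOn_id fun z hz => hz
  have h0 : ∀ c : ℂ, DifferentiableOn ℂ (fun _ : ℂ => c) {0}ᶜ := fun c => differentiableOn_const _
  fin_cases i <;> fin_cases j
  · exact h0 1
  · exact h0 0
  · exact (h _).neg
  · exact (h _).neg.mul_const _
  · exact h0 _
  · exact h0 _
  · exact (h _).neg.mul_const _
  · exact h0 _
  · exact h0 _

lemma differentiableOn_colY (q₀ : ℝ) (q : V) (j : Fin 3) :
    DifferentiableOn ℂ (colY q₀ q j) {0}ᶜ :=
  differentiableOn_pi.2 fun i => differentiableOn_matY q₀ q i j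

lemma differentiableOn_mcl_gen (q₀ : ℝ) (q : V) (j : Fin 3) :
    DifferentiableOn ℂ (fun z => mcl (gen q₀ q j z)) {0}ᶜ := by
  have h : (fun z => mcl (gen q₀ q j z)) = fun z =>
      -(Complex.I * specK q₀ z) • mcl matJ + mcl (matQ q) - (Complex.I * lam1 q₀ z j) • 1 := by
    funext z
    simp only [gen, matA, map_sub, map_add, map_smul, map_one]
  rw [h]
  exact ((((differentiableOn_specK q₀).const_mul _).neg.smul_const _).add_const _).sub
    (((differentiableOn_lam1 q₀ j).const_mul _).smul_const _)

lemma differentiableOn_jostKernel (ε q₀ : ℝ) (q : V) (j : Fin 3) (s : ℝ) :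
    DifferentiableOn ℂ (fun z => jostKernel ε q₀ q j z s) {0}ᶜ := by
  refine DifferentiableOn.comp (t := univ) (g := NormedSpace.exp) (fun a _ => ?_)
    ((differentiableOn_mcl_gen q₀ q j).const_smul (ε * s : ℂ)) (mapsTo_univ _ _)
  exact (NormedSpace.exp_analytic (𝕂 := ℂ) a).differentiableAt.differentiableWithinAt

lemma continuous_jostKernel (ε q₀ : ℝ) (q : V) (j : Fin 3) (z : ℂ) :
    Continuous (jostKernel ε q₀ q j z) :=
  (continuous_iff_continuousAt.2 fun a => (NormedSpace.exp_analytic (𝕂 := ℂ) a).continuousAt).comp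
    (by fun_prop)

/-- Admissibility makes every diagonal exponential have modulus at most one, which leaves the
condition number of `Y`, independent of `s`. -/
lemma norm_jostKernel_le {ε q₀ : ℝ} {q : V} {j : Fin 3} {z : ℂ} (hq : ‖q‖ = q₀) (h0 : q₀ ≠ 0)
    (hz : z ∈ admissible ε q₀ j) (hd : 1 + (q₀ : ℂ) ^ 2 / z ^ 2 ≠ 0) {s : ℝ} (hs : 0 ≤ s) :
    ‖jostKernel ε q₀ q j z s‖ ≤ ‖mcl (matY q₀ q z)‖ * ‖mcl (matY q₀ q z)⁻¹‖ := by
  rw [jostKernel_eq hq h0 hz.1 hd, map_mul, map_mul]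
  refine (norm_mul_le _ _).trans (mul_le_mul_of_nonneg_right ?_ (norm_nonneg _))
  refine (norm_mul_le _ _).trans (mul_le_of_le_one_right (norm_nonneg _)
    (norm_mcl_diagonal_le fun l => ?_))
  rw [Complex.norm_exp, Real.exp_le_one_iff]
  have h1 := mul_nonneg hs (hz.2 l)
  have h2 : (Complex.I * (ε * s) * (lam1 q₀ z l - lam1 q₀ z j)).re
      = -(s * (ε * (lam1 q₀ z l - lam1 q₀ z j).im)) := by
    simp [Complex.mul_re, Complex.mul_im]; ring
  rw [h2]; linarith

lemma continuousOn_norm_matY_mul {q₀ : ℝ} {q : V} (hq : ‖q‖ = q₀) (h0 : q₀ ≠ 0) :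
    ContinuousOn (fun z => ‖mcl (matY q₀ q z)‖ * ‖mcl (matY q₀ q z)⁻¹‖)
      {z | z ≠ 0 ∧ 1 + (q₀ : ℂ) ^ 2 / z ^ 2 ≠ 0} := by
  have hY : ContinuousOn (matY q₀ q) {z | z ≠ 0 ∧ 1 + (q₀ : ℂ) ^ 2 / z ^ 2 ≠ 0} :=
    continuousOn_pi.2 fun i => continuousOn_pi.2 fun j =>
      (differentiableOn_matY q₀ q i j).continuousOn.mono fun z hz => hz.1
  refine (continuous_mcl.comp_continuousOn hY).norm.mul
    (continuous_mcl.comp_continuousOn fun z hz => ?_).norm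
  refine ContinuousAt.comp_continuousWithinAt (g := Inv.inv) ?_ (hY z hz)
  have hne : (matY q₀ q z).det ≠ 0 := by rw [det_matY hq h0 hz.1]; exact hz.2
  refine continuousAt_matrix_inv _ ?_
  rw [Ring.inverse_eq_inv']
  exact continuousAt_inv₀ hne

lemma isOpen_det_ne (q₀ : ℝ) : IsOpen {z : ℂ | z ≠ 0 ∧ 1 + (q₀ : ℂ) ^ 2 / z ^ 2 ≠ 0} := by
  have h : ContinuousOn (fun z : ℂ => 1 + (q₀ : ℂ) ^ 2 / z ^ 2) {0}ᶜ :=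
    continuousOn_const.add (continuousOn_const.div (continuousOn_id.pow 2)
      fun z hz => pow_ne_zero 2 hz)
  exact h.isOpen_inter_preimage isOpen_compl_singleton isOpen_compl_singleton

/-- Away from `±iq₀` the condition number of `Y` is locally bounded. At `±iq₀` it is not available,
but for each `s` the kernel is holomorphic in `z`, so its bound on a small circle, uniform in `s`,
passes to the disc by the maximum principle. This requires the point to be interior to `S`. -/
lemma jostKernel_locally_bounded {ε q₀ : ℝ} {q : V} {j : Fin 3} (hq : ‖q‖ = q₀) (h0 : 0 < q₀)
    {S : Set ℂ} (hS : S ⊆ admissible ε q₀ j) {z₀ : ℂ} (hz₀ : z₀ ∈ S)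
    (hint : 1 + (q₀ : ℂ) ^ 2 / z₀ ^ 2 ≠ 0 ∨ z₀ ∈ interior S) :
    ∃ U ∈ 𝓝 z₀, ∃ B, ∀ z ∈ U ∩ S, ∀ s, 0 ≤ s → ‖jostKernel ε q₀ q j z s‖ ≤ B := by
  have hcont := continuousOn_norm_matY_mul hq h0.ne'
  by_cases hd : 1 + (q₀ : ℂ) ^ 2 / z₀ ^ 2 ≠ 0
  · have hmem := (isOpen_det_ne q₀).mem_nhds ⟨(hS hz₀).1, hd⟩
    have hev := (hcont.continuousAt hmem).eventually (gt_mem_nhds (lt_add_one _))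
    exact ⟨_, inter_mem hmem hev, _, fun z hz s hs =>
      (norm_jostKernel_le hq h0.ne' (hS hz.2) hz.1.1.2 hs).trans hz.1.2.le⟩
  · have hin := hint.resolve_left hd
    obtain ⟨ρ', hρ', hball⟩ := Metric.mem_nhds_iff.1 (mem_interior_iff_mem_nhds.1 hin)
    -- The cap `q₀` keeps the circle away from the other zero `-z₀` of the determinant, at distance
    -- `2q₀`.
    set ρ := min (ρ' / 2) q₀ with hρ
    have hρ0 : 0 < ρ := lt_min (by linarith) h0
    have hcb : Metric.closedBall z₀ ρ ⊆ S := (Metric.closedBall_subset_ball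
      ((min_le_left _ _).trans_lt (by linarith))).trans hball
    have hsq : z₀ ^ 2 = -(q₀ : ℂ) ^ 2 := by
      have hz0 := (hS hz₀).1
      push Not at hd
      field_simp at hd
      linear_combination hd
    have hnorm : ‖z₀‖ = q₀ := by
      have := congrArg norm hsq
      rw [norm_neg, norm_pow, norm_pow, Complex.norm_real, Real.norm_of_nonneg h0.le] at this
      exact (pow_left_inj₀ (norm_nonneg _) h0.le two_ne_zero).1 this
    have hsph : Metric.sphere z₀ ρ ⊆ {z | z ≠ 0 ∧ 1 + (q₀ : ℂ) ^ 2 / z ^ 2 ≠ 0} := by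
      intro z hz
      have hz0 : z ≠ 0 := (hS (hcb (Metric.sphere_subset_closedBall hz))).1
      refine ⟨hz0, fun hcon => ?_⟩
      have hzz : (z - z₀) * (z + z₀) = 0 := by
        field_simp at hcon
        linear_combination hcon - hsq
      rw [mem_sphere_iff_norm] at hz
      rcases mul_eq_zero.1 hzz with h | h
      · rw [h, norm_zero] at hz; exact hρ0.ne hz
      · rw [show z - z₀ = -(2 * z₀) by linear_combination h, norm_neg, norm_mul, hnorm] at hz
        have : ρ ≤ q₀ := min_le_right _ _
        simp at hz
        linarith
    obtain ⟨B, hB⟩ := (isCompact_sphere z₀ ρ).exists_bound_of_continuousOn (hcont.mono hsph)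
    refine ⟨_, Metric.closedBall_mem_nhds z₀ hρ0, B, fun z hz s hs => ?_⟩
    refine Complex.norm_le_of_forall_mem_frontier_norm_le (U := Metric.ball z₀ ρ)
      Metric.isBounded_ball (f := fun z => jostKernel ε q₀ q j z s)
      (DifferentiableOn.diffContOnCl ((differentiableOn_jostKernel ε q₀ q j s).mono ?_))
      (fun w hw => ?_) ?_
    · rw [closure_ball _ hρ0.ne']
      exact fun w hw => (hS (hcb hw)).1
    · rw [frontier_ball _ hρ0.ne'] at hw
      refine (norm_jostKernel_le hq h0.ne' (hS (hcb (Metric.sphere_subset_closedBall hw)))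
        (hsph hw).2 hs).trans ((le_abs_self _).trans (hB w hw))
    · rw [closure_ball _ hρ0.ne']; exact hz.1

/-! ### The columns of the Jost eigenfunctions as Neumann series -/

/-- The perturbation `A - A_∞` in the Volterra equations, reflected if `ε = -1`. -/
def jostW (ε : ℝ) (q : V) (u : ℝ → V) (r : ℝ) : C3 →L[ℂ] C3 :=
  (ε : ℂ) • mcl (matQ (u (ε * r)) - matQ q)

/-- `v ↦ Q(v)` as a real-linear continuous map. -/
def matQL : V →L[ℝ] (C3 →L[ℂ] C3) :=
  LinearMap.toContinuousLinearMap
    { toFun := fun v => mcl (matQ v)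
      map_add' := fun v w => by
        rw [← map_add]; congr 1
        ext i j; fin_cases i <;> fin_cases j <;> simp [matQ] <;> ring
      map_smul' := fun c v => by
        have h : matQ (c • v) = (c : ℂ) • matQ v := by
          ext i j; fin_cases i <;> fin_cases j <;> simp [matQ]
        rw [RingHom.id_apply, h, map_smul]; rfl }

lemma jostW_eq (ε : ℝ) (q : V) (u : ℝ → V) (r : ℝ) :
    jostW ε q u r = (ε : ℂ) • matQL (u (ε * r) - q) := by
  rw [jostW, map_sub, map_sub]; rfl

lemma integrableOn_jostW_minus {q : V} {u : ℝ → V}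
    (hm : ∀ a : ℝ, IntegrableOn (fun x => u x - q) (Iio a)) (a : ℝ) :
    IntegrableOn (jostW 1 q u) (Iic a) := by
  have h := (matQL.integrable_comp ((hm (a + 1)).mono_set (Iic_subset_Iio.2 (lt_add_one a)) :
    IntegrableOn (fun x => u x - q) (Iic a)))
  refine h.congr (Eventually.of_forall fun r => ?_)
  simp [jostW_eq]

lemma integrableOn_jostW_plus {q : V} {u : ℝ → V}
    (hp : ∀ a : ℝ, IntegrableOn (fun x => u x - q) (Ioi a)) (a : ℝ) :
    IntegrableOn (jostW (-1) q u) (Iic a) := by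
  have h1 : IntegrableOn (fun x => u (-x) - q) (Iio (a + 1)) := by
    have := (Measure.measurePreserving_neg (volume : Measure ℝ)).integrableOn_comp_preimage
      (Homeomorph.neg ℝ).measurableEmbedding (f := fun x => u x - q) (s := Ioi (-(a + 1)))
    simpa [Function.comp_def] using this.2 (hp _)
  have h := (matQL.integrable_comp (h1.mono_set (Iic_subset_Iio.2 (lt_add_one a)) :
    IntegrableOn (fun x => u (-x) - q) (Iic a))).neg
  refine h.congr (Eventually.of_forall fun r => ?_)
  simp [jostW_eq]
  module

/-- The `j`-th column of the modified Jost eigenfunction, reflected if `ε = -1`. -/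
def jostCol (ε q₀ : ℝ) (q : V) (u : ℝ → V) (j : Fin 3) (z : ℂ) : ℝ → C3 :=
  volterraSol (jostKernel ε q₀ q j z) (jostW ε q u) (colY q₀ q j z)

lemma jostCol_parameter {ε q₀ : ℝ} {q : V} {u : ℝ → V} {j : Fin 3} (hq : ‖q‖ = q₀) (h0 : 0 < q₀)
    (hW : ∀ a, IntegrableOn (jostW ε q u) (Iic a)) {D S : Set ℂ} (hD : IsOpen D) (hDS : D ⊆ S)
    (hS : S ⊆ admissible ε q₀ j) (hint : ∀ z ∈ S, 1 + (q₀ : ℂ) ^ 2 / z ^ 2 ≠ 0 ∨ z ∈ D) (x : ℝ) :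
    ContinuousOn (fun z => jostCol ε q₀ q u j z x) S ∧
    DifferentiableOn ℂ (fun z => jostCol ε q₀ q u j z x) D := by
  have hS0 : S ⊆ {0}ᶜ := fun z hz => (hS hz).1
  exact volterraSol_parameter hD hDS (fun z _ => continuous_jostKernel ε q₀ q j z)
    (fun z hz => jostKernel_locally_bounded hq h0 hS hz
      ((hint z hz).imp_right fun h => interior_maximal hDS hD h)) hW
    (fun s => (differentiableOn_jostKernel ε q₀ q j s).continuousOn.mono hS0)
    (fun s => (differentiableOn_jostKernel ε q₀ q j s).mono (hDS.trans hS0))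
    ((differentiableOn_colY q₀ q j).continuousOn.mono hS0)
    ((differentiableOn_colY q₀ q j).mono (hDS.trans hS0)) x

/-! ### From Volterra equations to differential equations; the Wronskian -/

section ODE

lemma absolutelyContinuous_intervalIntegral {F : Type*} [NormedAddCommGroup F] [NormedSpace ℝ F]
    {h : ℝ → F} (hh : LocallyIntegrable h) (c a b : ℝ) :
    AbsolutelyContinuousOnInterval (fun x => ∫ r in c..x, h r) a b := by
  have hi : ∀ x y, IntervalIntegrable h volume x y := fun x y =>
    (hh.integrableOn_isCompact isCompact_uIcc).intervalIntegrable
  refine absolutelyContinuous_of_dist_le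
    ((hi a b).norm.absolutelyContinuousOnInterval_intervalIntegral left_mem_uIcc) fun x _ y _ => ?_
  rw [dist_comm, dist_comm (∫ _ in a..x, _), dist_eq_norm, dist_eq_norm,
    intervalIntegral.integral_interval_sub_left (hi _ _) (hi _ _),
    intervalIntegral.integral_interval_sub_left (hi _ _).norm (hi _ _).norm, Real.norm_eq_abs]
  exact intervalIntegral.norm_integral_le_abs_integral_norm

lemma eq_of_absolutelyContinuous_of_hasDerivAt_zero {F : Type*} [NormedAddCommGroup F]
    [NormedSpace ℝ F] {f : ℝ → F} (hf : ∀ a b, AbsolutelyContinuousOnInterval f a b)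
    (hd : ∀ᵐ x, HasDerivAt f 0 x) (x y : ℝ) : f x = f y := by
  obtain ⟨C, hC⟩ := (hf x y).const_of_ae_hasDerivAt_zero (hd.mono fun _ h _ => h)
  rw [hC x left_mem_uIcc, hC y right_mem_uIcc]

variable {E : Type*} [NormedAddCommGroup E] [NormedSpace ℂ E]

lemma absolutelyContinuous_clm_apply {P : ℝ → E →L[ℂ] E} {n : ℝ → E} {a b : ℝ}
    (hP : AbsolutelyContinuousOnInterval P a b) (hn : AbsolutelyContinuousOnInterval n a b) :
    AbsolutelyContinuousOnInterval (fun x => P x (n x)) a b := by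
  obtain ⟨C, hC⟩ := hP.exists_bound
  obtain ⟨D, hD⟩ := hn.exists_bound
  unfold AbsolutelyContinuousOnInterval at hP hn
  refine squeeze_zero' (Eventually.of_forall fun _ => Finset.sum_nonneg fun _ _ => dist_nonneg) ?_
    (by simpa using (hn.const_mul C).add (hP.const_mul D))
  rw [eventually_inf_principal]
  filter_upwards with I hI
  simp only [Finset.mul_sum, ← Finset.sum_add_distrib]
  refine Finset.sum_le_sum fun i hi => ?_
  set x := (I.2 i).1
  set y := (I.2 i).2
  have hx : ‖P x‖ ≤ C := hC x (hI.1 i hi).1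
  have hy : ‖n y‖ ≤ D := hD y (hI.1 i hi).2
  simp only [dist_eq_norm]
  calc ‖P x (n x) - P y (n y)‖ = ‖P x (n x - n y) + (P x - P y) (n y)‖ := by
        simp
    _ ≤ ‖P x‖ * ‖n x - n y‖ + ‖P x - P y‖ * ‖n y‖ := (norm_add_le _ _).trans
        (add_le_add ((P x).le_opNorm _) ((P x - P y).le_opNorm _))
    _ ≤ C * ‖n x - n y‖ + D * ‖P x - P y‖ := by
        rw [mul_comm D]
        gcongr

lemma locallyIntegrable_clm_apply {W : ℝ → E →L[ℂ] E} {f : ℝ → E} (hW : LocallyIntegrable W)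
    (hf : Continuous f) : LocallyIntegrable fun r => W r (f r) := by
  rw [locallyIntegrable_iff]
  intro K hK
  obtain ⟨C, hC⟩ := hK.exists_bound_of_continuousOn hf.continuousOn
  have hWK := hW.integrableOn_isCompact hK
  refine (hWK.norm.const_mul C).mono'
    (aestronglyMeasurable_clm_apply hWK.1 hf.aestronglyMeasurable) ?_
  filter_upwards [ae_restrict_mem hK.measurableSet] with r hr
  refine ((W r).le_opNorm _).trans ?_
  rw [mul_comm]
  exact mul_le_mul_of_nonneg_right (hC r hr) (norm_nonneg _)

variable [CompleteSpace E]

/-- A solution of the Volterra equation with kernel `exp (s b)` solves `m' = (b + V) m`. -/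
lemma volterra_ode {b : E →L[ℂ] E} {V : ℝ → E →L[ℂ] E} {y : E} {m : ℝ → E} {B : ℝ}
    (hB : ∀ s : ℝ, ‖NormedSpace.exp ((s : ℂ) • b)‖ ≤ B) (hby : b y = 0)
    (hV : ∀ a, IntegrableOn V (Iic a)) (hm : Continuous m)
    (hbd : ∀ x, ∃ C, ∀ r ≤ x, ‖m r‖ ≤ C)
    (heq : ∀ x, m x = y + ∫ r in Iic x, NormedSpace.exp (((x - r : ℝ) : ℂ) • b) (V r (m r)))
    (x : ℝ) : m x = m 0 + ∫ r in 0..x, (b (m r) + V r (m r)) := by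
  set k : ℝ → E →L[ℂ] E := fun s => NormedSpace.exp ((s : ℂ) • b) with hk
  have hkc : ContDiff ℝ 1 k := by
    have h1 : ContDiff ℂ 1 (NormedSpace.exp : (E →L[ℂ] E) → E →L[ℂ] E) :=
      contDiff_iff_contDiffAt.2 fun a => (NormedSpace.exp_analytic (𝕂 := ℂ) a).contDiffAt
    exact (h1.restrict_scalars ℝ).comp (Complex.ofRealCLM.contDiff.smul contDiff_const)
  have hof : ∀ s : ℝ, HasDerivAt (fun s : ℝ => (s : ℂ)) 1 s := fun s =>
    Complex.ofRealCLM.hasDerivAt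
  have hkd : ∀ s, HasDerivAt k (b * k s) s := fun s => by
    exact ((hasDerivAt_exp_smul_const' (𝕂 := ℂ) b (s : ℂ)).scomp s (hof s)).congr_deriv
      (one_smul _ _)
  have hkd' : ∀ s, HasDerivAt k (k s * b) s := fun s => by
    exact ((hasDerivAt_exp_smul_const (𝕂 := ℂ) b (s : ℂ)).scomp s (hof s)).congr_deriv
      (one_smul _ _)
  have hkadd : ∀ s t, k (s + t) = k s * k t := by
    intro s t
    simp only [hk]
    have hball : ∀ a : E →L[ℂ] E,
        a ∈ Metric.eball 0 (NormedSpace.expSeries ℂ (E →L[ℂ] E)).radius := fun a =>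
      (NormedSpace.expSeries_radius_eq_top ℂ (E →L[ℂ] E)).symm ▸ edist_lt_top _ _
    rw [← NormedSpace.exp_add_of_commute_of_mem_ball (𝕂 := ℂ)
      (((Commute.refl b).smul_left _).smul_right _) (hball _) (hball _), ← add_smul,
      Complex.ofReal_add]
  have hk0 : k 0 = 1 := by simp [hk, NormedSpace.exp_zero]
  have happ : ∀ {n : ℝ → E} {n' : E} {s : ℝ}, HasDerivAt n n' s →
      HasDerivAt (fun s => k s (n s)) (b (k s (n s)) + k s n') s := by
    intro n n' s hn
    have h1 := (ContinuousLinearMap.restrictScalarsL ℂ E E ℝ ℝ).hasFDerivAt.comp_hasDerivAt s (hkd s)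
    exact HasDerivAt.clm_apply h1 hn
  have hky : ∀ s, k s y = y := by
    intro s
    have h1 : ∀ s, HasDerivAt (fun s => k s y) 0 s := by
      intro s
      have h3 := ((ContinuousLinearMap.apply ℂ E y).restrictScalars ℝ).hasFDerivAt.comp_hasDerivAt s (hkd' s)
      refine h3.congr_deriv ?_
      simp [hby]
    have h4 := is_const_of_deriv_eq_zero (fun s => (h1 s).differentiableAt)
      (fun s => (h1 s).deriv) s 0
    rw [h4, hk0]; rfl
  -- Variation of constants: since `exp(xb)` fixes `y`, the solution is `exp(xb)` applied to `y + ∫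
  -- exp(-rb) V m`. Integrability of this integrand down to `-∞` uses the bound on the kernel for
  -- both signs of `s`.
  set h : ℝ → E := fun r => k (-r) (V r (m r)) with hh
  have hVm : ∀ a, IntegrableOn (fun r => V r (m r)) (Iic a) := fun a =>
    let ⟨_, hC⟩ := hbd a
    integrableOn_clm_apply (hV a) hm hC
  have hhi : ∀ a, IntegrableOn h (Iic a) := by
    intro a
    refine ((hVm a).norm.const_mul B).mono' (aestronglyMeasurable_clm_apply
      (hkc.continuous.comp continuous_neg).aestronglyMeasurable (hVm a).1) ?_
    exact Eventually.of_forall fun r => (k (-r)).le_of_opNorm_le (hB _) _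
  set n : ℝ → E := fun x => ∫ r in Iic x, h r with hn
  have hmn : ∀ x, m x = k x (y + n x) := by
    intro x
    rw [map_add, hky, hn, heq x]
    congr 1
    rw [← ContinuousLinearMap.integral_comp_comm _ (hhi x)]
    refine integral_congr_ae (Eventually.of_forall fun r => ?_)
    have h1 := hkadd x (-r)
    rw [← sub_eq_add_neg] at h1
    exact congrArg (fun f : E →L[ℂ] E => f (V r (m r))) h1
  have hloc : LocallyIntegrable fun r => b (m r) + V r (m r) :=
    ((b.continuous.comp hm).locallyIntegrable).add (locallyIntegrable_of_Iic hVm)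
  have key := eq_of_absolutelyContinuous_of_hasDerivAt_zero
    (f := fun x => m x - ∫ r in 0..x, (b (m r) + V r (m r))) (fun a c => ?_) ?_ x 0
  · simp only [intervalIntegral.integral_same, sub_zero] at key
    rw [← key]; abel
  · refine AbsolutelyContinuousOnInterval.sub ?_ (absolutelyContinuous_intervalIntegral hloc 0 a c)
    have h1 : m = fun x => k x (y + n x) := funext hmn
    rw [h1]
    refine absolutelyContinuous_clm_apply hkc.contDiffOn.absolutelyContinuousOnInterval ?_
    refine absolutelyContinuous_of_dist_le (absolutelyContinuous_integral_Iic hhi a c)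
      fun x _ z _ => by rw [dist_add_left]
  · filter_upwards [ae_hasDerivAt_integral_Iic hhi, LocallyIntegrable.ae_hasDerivAt_integral hloc]
      with x h1 h2
    have h3 := happ (h1.const_add y)
    have h4 : HasDerivAt m (b (m x) + V x (m x)) x := by
      refine (h3.congr_of_eventuallyEq (Eventually.of_forall hmn)).congr_deriv ?_
      rw [← hmn x]
      congr 1
      have h5 := hkadd x (-x)
      rw [add_neg_cancel, hk0] at h5
      exact (congrArg (fun f : E →L[ℂ] E => f (V x (m x))) h5).symm
    exact (h4.sub (h2 0)).congr_deriv (sub_self _)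

end ODE

/-- `m` solves `m' = (A - i θ) m` in integrated form. -/
structure IsODESol (A : ℝ → M3) (θ : ℂ) (m : ℝ → C3) : Prop where
  locInt : LocallyIntegrable fun r => (A r).mulVec (m r) - (Complex.I * θ) • m r
  eq : ∀ x, m x = m 0 + ∫ r in 0..x, ((A r).mulVec (m r) - (Complex.I * θ) • m r)

lemma IsODESol.absolutelyContinuous {A : ℝ → M3} {θ : ℂ} {m : ℝ → C3} (h : IsODESol A θ m)
    (a b : ℝ) (i : Fin 3) : AbsolutelyContinuousOnInterval (fun x => m x i) a b := by
  refine absolutelyContinuous_of_dist_le (absolutelyContinuous_intervalIntegral h.locInt 0 a b)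
    fun x _ y _ => ?_
  refine (dist_le_pi_dist (m x) (m y) i).trans_eq ?_
  rw [h.eq x, h.eq y, dist_add_left]

lemma IsODESol.ae_hasDerivAt {A : ℝ → M3} {θ : ℂ} {m : ℝ → C3} (h : IsODESol A θ m) :
    ∀ᵐ x, HasDerivAt m ((A x).mulVec (m x) - (Complex.I * θ) • m x) x := by
  filter_upwards [LocallyIntegrable.ae_hasDerivAt_integral h.locInt] with x hx
  exact ((hx 0).const_add (m 0)).congr_of_eventuallyEq (Eventually.of_forall h.eq)

/-- The sesquilinear Wronskian of two solutions is constant if `A` is anti-Hermitian. -/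
lemma IsODESol.wronskian {A : ℝ → M3} (hA : ∀ r, (A r).conjTranspose = -A r) {θ₁ θ₂ : ℝ}
    {m₁ m₂ : ℝ → C3} (h₁ : IsODESol A θ₁ m₁) (h₂ : IsODESol A θ₂ m₂) (x y : ℝ) :
    Complex.exp (Complex.I * ((θ₂ - θ₁) * x)) * (star (m₁ x) ⬝ᵥ m₂ x) =
    Complex.exp (Complex.I * ((θ₂ - θ₁) * y)) * (star (m₁ y) ⬝ᵥ m₂ y) := by
  set e : ℝ → ℂ := fun x => Complex.exp (Complex.I * ((θ₂ - θ₁) * x)) with he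
  have hed : ∀ x, HasDerivAt e (Complex.I * (θ₂ - θ₁) * e x) x := by
    intro x
    have h1 : HasDerivAt (fun w : ℂ => Complex.exp (Complex.I * ((θ₂ - θ₁) * w)))
        (Complex.I * (θ₂ - θ₁) * Complex.exp (Complex.I * ((θ₂ - θ₁) * x))) (x : ℂ) := by
      have h2 : HasDerivAt (fun w : ℂ => Complex.I * ((θ₂ - θ₁) * w)) (Complex.I * (θ₂ - θ₁)) (x : ℂ) := by
        simpa using ((hasDerivAt_id (x : ℂ)).const_mul ((θ₂ : ℂ) - θ₁)).const_mul Complex.I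
      rw [mul_comm]
      exact h2.cexp
    exact h1.comp_ofReal
  have hec : ContDiff ℝ 1 e := (contDiff_const.mul
    (contDiff_const.mul Complex.ofRealCLM.contDiff)).cexp
  refine eq_of_absolutelyContinuous_of_hasDerivAt_zero
    (f := fun x => e x * (star (m₁ x) ⬝ᵥ m₂ x)) (fun a b => ?_) ?_ x y
  · have hs : ∀ i, AbsolutelyContinuousOnInterval (fun x => star (m₁ x i)) a b := fun i =>
      absolutelyContinuous_of_dist_le (h₁.absolutelyContinuous a b i)
        fun x _ y _ => (Complex.dist_conj_conj _ _).le
    have hp : ∀ i, AbsolutelyContinuousOnInterval (fun x => star (m₁ x i) * m₂ x i) a b := fun i =>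
      (hs i).smul (h₂.absolutelyContinuous a b i)
    have hsum : AbsolutelyContinuousOnInterval (fun x => star (m₁ x) ⬝ᵥ m₂ x) a b := by
      simp only [dotProduct, Fin.sum_univ_three, Pi.star_apply]
      exact ((hp 0).add (hp 1)).add (hp 2)
    exact hec.contDiffOn.absolutelyContinuousOnInterval.smul hsum
  · filter_upwards [h₁.ae_hasDerivAt, h₂.ae_hasDerivAt] with x hx₁ hx₂
    rw [hasDerivAt_pi] at hx₁ hx₂
    have hdot : HasDerivAt (fun x => star (m₁ x) ⬝ᵥ m₂ x)
        (star ((A x).mulVec (m₁ x) - (Complex.I * θ₁) • m₁ x) ⬝ᵥ m₂ x +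
          star (m₁ x) ⬝ᵥ ((A x).mulVec (m₂ x) - (Complex.I * θ₂) • m₂ x)) x := by
      simp only [dotProduct, ← Finset.sum_add_distrib]
      exact HasDerivAt.fun_sum fun i _ => (hx₁ i).star.mul (hx₂ i)
    refine ((hed x).mul hdot).congr_deriv ?_
    -- Anti-Hermitian `A` cancels between the two factors; what remains of the derivative is the
    -- phase difference, compensated by the exponential.
    have hadj : star ((A x).mulVec (m₁ x)) ⬝ᵥ m₂ x = -(star (m₁ x) ⬝ᵥ (A x).mulVec (m₂ x)) := by
      rw [Matrix.star_mulVec, hA, ← Matrix.dotProduct_mulVec, Matrix.neg_mulVec, dotProduct_neg]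
    rw [star_sub, sub_dotProduct, dotProduct_sub, hadj, star_smul, smul_dotProduct,
      dotProduct_smul]
    simp
    ring

/-! ### Jost eigenfunctions for real spectral parameter -/

section RealAxis

variable {q₀ : ℝ} {q : V} {u : ℝ → V} {z : ℂ}

lemma exists_ofReal_of_mem_realAxis (hz : z ∈ realAxis) : ∃ x : ℝ, x ≠ 0 ∧ z = x :=
  ⟨z.re, fun h => hz.2 (Complex.ext h hz.1), Complex.ext rfl (by simpa using hz.1)⟩

lemma lam1_im (hz : z ∈ realAxis) (l : Fin 3) : (lam1 q₀ z l).im = 0 := by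
  obtain ⟨x, -, rfl⟩ := exists_ofReal_of_mem_realAxis hz
  have h1 : specLam q₀ x = ((x + q₀ ^ 2 / x) / 2 : ℝ) := by simp [specLam]
  have h2 : specK q₀ x = ((x - q₀ ^ 2 / x) / 2 : ℝ) := by simp [specK]
  fin_cases l <;> simp [lam1, h1, h2, -Complex.ofReal_div, -Complex.ofReal_add, -Complex.ofReal_sub]

lemma specK_im (hz : z ∈ realAxis) : (specK q₀ z).im = 0 := lam1_im hz 1

lemma realAxis_subset_admissible (ε : ℝ) (j : Fin 3) : realAxis ⊆ admissible ε q₀ j :=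
  fun z hz => ⟨hz.2, fun l => by simp [lam1_im hz]⟩

lemma one_add_ne_zero (hz : z ∈ realAxis) : 1 + (q₀ : ℂ) ^ 2 / z ^ 2 ≠ 0 := by
  obtain ⟨x, hx, rfl⟩ := exists_ofReal_of_mem_realAxis hz
  have : (0 : ℝ) < 1 + q₀ ^ 2 / x ^ 2 := by positivity
  exact_mod_cast this.ne'

lemma matA_sub (k : ℂ) (v w : V) : matA k v - matA k w = matQ v - matQ w := by
  simp [matA]

/-- The columns of the integrand of the Volterra equations, in terms of the kernel. -/
lemma volterraIntegrand_col {ε : ℝ} (hε : ε * ε = 1) (hq : ‖q‖ = q₀) (h0 : q₀ ≠ 0)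
    (hz : z ≠ 0) (hd : 1 + (q₀ : ℂ) ^ 2 / z ^ 2 ≠ 0) (ν : ℝ → M3) (x r : ℝ) (i j : Fin 3) :
    ε * volterraIntegrand q₀ q u z ν x r i j =
      jostKernel ε q₀ q j z (ε * x - ε * r) (jostW ε q u (ε * r) fun i => ν r i j) i := by
  have hεr : ε * (ε * r) = r := by rw [← mul_assoc, hε, one_mul]
  have hs : ((ε : ℂ) * ((ε * x - ε * r : ℝ) : ℂ)) = ((x - r : ℝ) : ℂ) := by
    rw [← Complex.ofReal_mul]; congr 1; linear_combination (x - r) * hε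
  -- On the `j`-th column the right factor `e^{-i(x-r)Λ₁}` is a scalar, which is absorbed into the
  -- diagonal of the left factor.
  have hdiag : (Matrix.diagonal fun l => Complex.exp (Complex.I * (ε * ((ε * x - ε * r : ℝ) : ℂ)) *
      (lam1 q₀ z l - lam1 q₀ z j))) =
      Complex.exp (Complex.I * ((-(x - r) : ℝ) : ℂ) * lam1 q₀ z j) • expLam1 q₀ z (x - r) := by
    rw [expLam1, ← Matrix.diagonal_smul, hs]
    congr 1
    funext l
    rw [Pi.smul_apply, smul_eq_mul, ← Complex.exp_add]
    congr 1
    push_cast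
    ring
  rw [jostKernel_eq hq h0 hz hd, hdiag, jostW, hεr, volterraIntegrand, matA_sub,
    expLam1, expLam1, Matrix.mul_diagonal, ← expLam1, Matrix.mul_smul, Matrix.smul_mul, map_smul]
  simp only [smul_apply, map_smul, Pi.smul_apply, smul_eq_mul, mcl_apply,
    Matrix.mulVec_mulVec]
  have h : ∀ M : M3, M.mulVec (fun i => ν r i j) i = (M * ν r) i j := fun _ => rfl
  rw [h]
  ring

/-- `m` solves the Volterra equation of the `j`-th column, in reflected form if `ε = -1`. -/
structure IsJostCol (ε q₀ : ℝ) (q : V) (u : ℝ → V) (j : Fin 3) (z : ℂ) (m : ℝ → C3) : Prop where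
  continuous : Continuous m
  bounded : ∀ x, ∃ C, ∀ r ≤ x, ‖m r‖ ≤ C
  volterra : ∀ x, m x = colY q₀ q j z +
    ∫ r in Iic x, jostKernel ε q₀ q j z (x - r) (jostW ε q u r (m r))

variable {ε : ℝ}

/-- For real `z` all `λ_l` are real, so both signs of `ε` are admissible; negative `s` is reduced to
positive `s` by changing the sign of `ε`. -/
lemma exists_norm_jostKernel_le (ε : ℝ) (hq : ‖q‖ = q₀) (h0 : q₀ ≠ 0) (hz : z ∈ realAxis)
    (j : Fin 3) : ∃ B, ∀ s : ℝ, ‖jostKernel ε q₀ q j z s‖ ≤ B := by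
  refine ⟨‖mcl (matY q₀ q z)‖ * ‖mcl (matY q₀ q z)⁻¹‖, fun s => ?_⟩
  rcases le_total 0 s with hs | hs
  · exact norm_jostKernel_le hq h0 (realAxis_subset_admissible ε j hz) (one_add_ne_zero hz) hs
  · have h1 := norm_jostKernel_le hq h0 (realAxis_subset_admissible (-ε) j hz)
      (one_add_ne_zero hz) (neg_nonneg.2 hs)
    refine (congrArg norm ?_).trans_le h1
    simp [jostKernel]

lemma isJostCol_jostCol (hq : ‖q‖ = q₀) (h0 : q₀ ≠ 0) (hz : z ∈ realAxis)
    (hW : ∀ a, IntegrableOn (jostW ε q u) (Iic a)) (j : Fin 3) :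
    IsJostCol ε q₀ q u j z (jostCol ε q₀ q u j z) := by
  obtain ⟨B, hB⟩ := exists_norm_jostKernel_le ε hq h0 hz j
  have hk := continuous_jostKernel ε q₀ q j z
  exact ⟨continuous_volterraSol hk (fun s _ => hB s) hW _,
    fun x => ⟨_, fun r hr => norm_volterraSol_le hk (fun s _ => hB s) hW _ hr⟩,
    fun x => volterraSol_eq hk (fun s _ => hB s) hW _ x⟩

lemma IsJostCol.eq_jostCol (hq : ‖q‖ = q₀) (h0 : q₀ ≠ 0) (hz : z ∈ realAxis)
    (hW : ∀ a, IntegrableOn (jostW ε q u) (Iic a)) {j : Fin 3} {m : ℝ → C3}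
    (hm : IsJostCol ε q₀ q u j z m) : m = jostCol ε q₀ q u j z := by
  obtain ⟨B, hB⟩ := exists_norm_jostKernel_le ε hq h0 hz j
  have h := isJostCol_jostCol hq h0 hz hW j
  exact volterra_unique (continuous_jostKernel ε q₀ q j z) (fun s _ => hB s) hW hm.continuous
    h.continuous hm.bounded h.bounded hm.volterra h.volterra

lemma IsJostCol.integrableOn (hq : ‖q‖ = q₀) (h0 : q₀ ≠ 0) (hz : z ∈ realAxis)
    (hW : ∀ a, IntegrableOn (jostW ε q u) (Iic a)) {j : Fin 3} {m : ℝ → C3}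
    (hc : Continuous m) (hb : ∀ x, ∃ C, ∀ r ≤ x, ‖m r‖ ≤ C) (x : ℝ) :
    IntegrableOn (fun r => jostKernel ε q₀ q j z (x - r) (jostW ε q u r (m r))) (Iic x) := by
  obtain ⟨B, hB⟩ := exists_norm_jostKernel_le ε hq h0 hz j
  obtain ⟨C, hC⟩ := hb x
  exact integrableOn_conv (continuous_jostKernel ε q₀ q j z) (fun s _ => hB s)
    (integrableOn_clm_apply (hW x) hc hC)

lemma integral_pi_apply {μ : Measure ℝ} {f : ℝ → C3} (hf : Integrable f μ) (i : Fin 3) :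
    (∫ r, f r ∂μ) i = ∫ r, f r i ∂μ :=
  ((ContinuousLinearMap.proj (R := ℂ) (φ := fun _ : Fin 3 => ℂ) i).integral_comp_comm hf).symm

lemma exists_bound_Iic {m : ℝ → C3} (hc : Continuous m) {C : ℝ}
    (hC : ∀ r ≤ 0, ‖m r‖ ≤ C) (x : ℝ) : ∃ C, ∀ r ≤ x, ‖m r‖ ≤ C := by
  obtain ⟨C', hC'⟩ := (isCompact_Icc (a := (0 : ℝ)) (b := x)).exists_bound_of_continuousOn
    hc.continuousOn
  refine ⟨max C C', fun r hr => ?_⟩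
  rcases le_total r 0 with h | h
  · exact (hC r h).trans (le_max_left _ _)
  · exact (hC' r ⟨h, hr⟩).trans (le_max_right _ _)

/-- Column by column, existence and uniqueness for the Volterra equation identify the modified Jost
eigenfunction with the Neumann series, so nothing depends on a choice of `ν`. -/
lemma isJostMinus_iff (hq : ‖q‖ = q₀) (h0 : q₀ ≠ 0) (hz : z ∈ realAxis)
    (hW : ∀ a, IntegrableOn (jostW 1 q u) (Iic a)) {ν : ℝ → M3} :
    IsJostMinus q₀ q u z ν ↔ ∀ x i j, ν x i j = jostCol 1 q₀ q u j z x i := by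
  have hint : ∀ x r i j, volterraIntegrand q₀ q u z ν x r i j =
      jostKernel 1 q₀ q j z (x - r) (jostW 1 q u r fun i => ν r i j) i := fun x r i j => by
    simpa using volterraIntegrand_col (ε := 1) (by norm_num) hq h0 hz.2 (one_add_ne_zero hz) ν x r i j
  constructor
  · intro h x i j
    obtain ⟨C, hC⟩ := h.bounded
    have hc : Continuous fun x => (fun i => ν x i j : C3) :=
      continuous_pi fun i => (h.continuous.matrix_elem i j)
    have hb := exists_bound_Iic hc (C := C) fun r hr =>
      (pi_norm_le_iff_of_nonneg ((norm_nonneg _).trans (hC r hr 0 0))).2 fun i => hC r hr i j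
    have hcol : IsJostCol 1 q₀ q u j z fun x i => ν x i j := by
      refine ⟨hc, hb, fun x => ?_⟩
      funext i
      rw [Pi.add_apply, integral_pi_apply (IsJostCol.integrableOn hq h0 hz hW hc hb x)]
      simp_rw [← hint]
      exact h.volterra x i j
    exact congrFun (congrFun (hcol.eq_jostCol hq h0 hz hW) x) i
  · intro h
    have hJ := isJostCol_jostCol hq h0 hz hW
    have hcol : ∀ r j, (fun i => ν r i j) = jostCol 1 q₀ q u j z r := fun r j =>
      funext fun i => h r i j
    refine ⟨?_, ?_, fun x i j => ?_⟩
    · refine continuous_matrix fun i j => ?_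
      simp_rw [h]
      exact (continuous_apply i).comp (hJ j).continuous
    · choose C hC using fun j => (hJ j).bounded 0
      refine ⟨max (C 0) (max (C 1) (C 2)), fun x hx i j => ?_⟩
      rw [h]
      refine (norm_le_pi_norm _ i).trans ((hC j x hx).trans ?_)
      fin_cases j <;> simp
    · rw [h, (hJ j).volterra x, Pi.add_apply, integral_pi_apply
        (IsJostCol.integrableOn hq h0 hz hW (hJ j).continuous (hJ j).bounded x)]
      simp_rw [hint, hcol]
      rfl

/-- The reflection `x ↦ -x` turns the equation normalized at `+∞` into one on `(-∞, x]`, so the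
theory at `-∞` applies with `ε = -1`. -/
lemma isJostPlus_iff (hq : ‖q‖ = q₀) (h0 : q₀ ≠ 0) (hz : z ∈ realAxis)
    (hW : ∀ a, IntegrableOn (jostW (-1) q u) (Iic a)) {ν : ℝ → M3} :
    IsJostPlus q₀ q u z ν ↔ ∀ x i j, ν x i j = jostCol (-1) q₀ q u j z (-x) i := by
  have hint : ∀ x r i j, -volterraIntegrand q₀ q u z ν (-x) (-r) i j =
      jostKernel (-1) q₀ q j z (x - r) (jostW (-1) q u r fun i => ν (-r) i j) i := fun x r i j => by
    simpa using volterraIntegrand_col (ε := -1) (by norm_num) hq h0 hz.2 (one_add_ne_zero hz) ν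
      (-x) (-r) i j
  have hrefl : ∀ x i j, -∫ r in Ioi (-x), volterraIntegrand q₀ q u z ν (-x) r i j =
      ∫ r in Iic x, -volterraIntegrand q₀ q u z ν (-x) (-r) i j := fun x i j => by
    rw [integral_neg, integral_comp_neg_Iic x fun r => volterraIntegrand q₀ q u z ν (-x) r i j]
  constructor
  · intro h x i j
    obtain ⟨C, hC⟩ := h.bounded
    have hc : Continuous fun x => (fun i => ν (-x) i j : C3) :=
      continuous_pi fun i => ((h.continuous.comp continuous_neg).matrix_elem i j)
    have hb := exists_bound_Iic hc (C := C) fun r hr =>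
      (pi_norm_le_iff_of_nonneg ((norm_nonneg _).trans (hC 0 le_rfl 0 0))).2
        fun i => hC (-r) (neg_nonneg.2 hr) i j
    have hcol : IsJostCol (-1) q₀ q u j z fun x i => ν (-x) i j := by
      refine ⟨hc, hb, fun x => ?_⟩
      funext i
      rw [Pi.add_apply, integral_pi_apply (IsJostCol.integrableOn hq h0 hz hW hc hb x)]
      simp_rw [← hint]
      rw [← hrefl, ← sub_eq_add_neg]
      exact h.volterra (-x) i j
    have h1 := congrFun (congrFun (hcol.eq_jostCol hq h0 hz hW) (-x)) i
    simpa using h1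
  · intro h
    have hJ := isJostCol_jostCol hq h0 hz hW
    have hcol : ∀ r j, (fun i => ν (-r) i j) = jostCol (-1) q₀ q u j z r := fun r j =>
      funext fun i => by rw [h, neg_neg]
    refine ⟨?_, ?_, fun x i j => ?_⟩
    · refine continuous_matrix fun i j => ?_
      simp_rw [h]
      exact (continuous_apply i).comp ((hJ j).continuous.comp continuous_neg)
    · choose C hC using fun j => (hJ j).bounded 0
      refine ⟨max (C 0) (max (C 1) (C 2)), fun x hx i j => ?_⟩
      rw [h]
      refine (norm_le_pi_norm _ i).trans ((hC j (-x) (neg_nonpos.2 hx)).trans ?_)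
      fin_cases j <;> simp
    · have h1 := hrefl (-x) i j
      rw [neg_neg] at h1
      rw [h, (hJ j).volterra (-x), Pi.add_apply, integral_pi_apply
        (IsJostCol.integrableOn hq h0 hz hW (hJ j).continuous (hJ j).bounded (-x)),
        sub_eq_add_neg, h1]
      have h2 := hint (-x)
      rw [neg_neg] at h2
      simp_rw [h2, hcol]
      rfl

/-- The kernel therefore fixes the normalization vector, as `volterra_ode` demands. -/
lemma gen_mulVec_colY (hq : ‖q‖ = q₀) (h0 : q₀ ≠ 0) (hz : z ≠ 0) (j : Fin 3) :
    (gen q₀ q j z).mulVec (colY q₀ q j z) = 0 := by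
  funext i
  have h := congrFun (congrFun (matA_mul_matY hq h0 hz) i) j
  rw [Matrix.mul_diagonal] at h
  rw [gen, Matrix.sub_mulVec, Matrix.smul_mulVec, Matrix.one_mulVec]
  have h' : (matA (specK q₀ z) q).mulVec (colY q₀ q j z) i =
      matY q₀ q z i j * (Complex.I * lam1 q₀ z j) := h
  simp only [Pi.sub_apply, Pi.smul_apply, smul_eq_mul, h', colY, Pi.zero_apply]
  ring

/-- In the physical variable the columns solve `m' = (A - i Λ_j) m`. -/
lemma isODESol_jostCol (hε : ε * ε = 1) (hq : ‖q‖ = q₀) (h0 : q₀ ≠ 0) (hz : z ∈ realAxis)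
    (hW : ∀ a, IntegrableOn (jostW ε q u) (Iic a)) (hu : LocallyIntegrable fun x => u x - q)
    (j : Fin 3) :
    IsODESol (fun r => matA (specK q₀ z) (u r)) (lam1 q₀ z j)
      fun x => jostCol ε q₀ q u j z (ε * x) := by
  obtain ⟨B, hB⟩ := exists_norm_jostKernel_le ε hq h0 hz j
  have hJ := isJostCol_jostCol hq h0 hz hW j
  have hrhs : ∀ r, (matA (specK q₀ z) (u r)).mulVec (jostCol ε q₀ q u j z (ε * r)) -
      (Complex.I * lam1 q₀ z j) • jostCol ε q₀ q u j z (ε * r) =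
      mcl (gen q₀ q j z) (jostCol ε q₀ q u j z (ε * r)) +
        matQL (u r - q) (jostCol ε q₀ q u j z (ε * r)) := by
    intro r
    have h1 : matQL (u r - q) = mcl (matQ (u r) - matQ q) := by
      rw [map_sub, map_sub]; rfl
    rw [h1, ← matA_sub (specK q₀ z), gen]
    simp only [mcl_apply, Matrix.sub_mulVec, Matrix.smul_mulVec, Matrix.one_mulVec]
    abel
  have hmc : Continuous fun r => jostCol ε q₀ q u j z (ε * r) :=
    hJ.continuous.comp (continuous_const.mul continuous_id)
  refine ⟨?_, fun x => ?_⟩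
  · simp_rw [hrhs]
    refine (((mcl (gen q₀ q j z)).continuous.comp hmc).locallyIntegrable).add
      (locallyIntegrable_clm_apply (W := fun r => matQL (u r - q)) ?_ hmc)
    rw [locallyIntegrable_iff] at hu ⊢
    exact fun K hK => matQL.integrable_comp (hu K hK)
  · have h1 := volterra_ode (b := (ε : ℂ) • mcl (gen q₀ q j z)) (B := B)
      (fun s => by
        have := hB s
        rwa [jostKernel, mul_comm (ε : ℂ), mul_smul] at this)
      (by
        rw [smul_apply, mcl_apply, gen_mulVec_colY hq h0 hz.2, smul_zero])
      hW hJ.continuous hJ.bounded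
      (fun x => by
        refine (hJ.volterra x).trans ?_
        simp_rw [jostKernel, mul_comm (ε : ℂ), mul_smul]) (ε * x)
    simp only [mul_zero]
    rw [h1]
    congr 1
    have h2 := intervalIntegral.smul_integral_comp_mul_left (a := 0) (b := x) (fun r =>
      ((ε : ℂ) • mcl (gen q₀ q j z)) (jostCol ε q₀ q u j z r) +
        jostW ε q u r (jostCol ε q₀ q u j z r)) ε
    rw [mul_zero] at h2
    rw [← h2, ← intervalIntegral.integral_smul]
    refine intervalIntegral.integral_congr fun r _ => ?_
    have hεr : ε * (ε * r) = r := by rw [← mul_assoc, hε, one_mul]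
    have hεc : (ε : ℂ) * ε = 1 := by exact_mod_cast hε
    simp only [hrhs, jostW_eq, hεr, smul_apply]
    rw [← smul_add, ← Complex.coe_smul, smul_smul, hεc, one_smul]

lemma matA_conjTranspose (hz : z ∈ realAxis) (v : V) :
    (matA (specK q₀ z) v).conjTranspose = -matA (specK q₀ z) v := by
  have h : star (specK q₀ z) = specK q₀ z := Complex.conj_eq_iff_im.2 (specK_im hz)
  simp only [Complex.star_def] at h
  rw [matA_eq]
  ext i j
  fin_cases i <;> fin_cases j <;> simp [h]

/-- The diagonal of `Y†Y`. -/
def normC (q₀ : ℝ) (z : ℂ) : Fin 3 → ℂ :=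
  ![1 + (q₀ : ℂ) ^ 2 / z ^ 2, 1, 1 + (q₀ : ℂ) ^ 2 / z ^ 2]

lemma colY_dotProduct (hq : ‖q‖ = q₀) (h0 : q₀ ≠ 0) (hz : z ∈ realAxis) (l j : Fin 3) :
    star (colY q₀ q l z) ⬝ᵥ colY q₀ q j z = if l = j then normC q₀ z j else 0 := by
  have hn := mul_star_add_mul_star hq
  have h0' : (q₀ : ℂ) ≠ 0 := by exact_mod_cast h0
  have hI := Complex.I_mul_I
  obtain ⟨x, hx, rfl⟩ := exists_ofReal_of_mem_realAxis hz
  have hx' : (x : ℂ) ≠ 0 := by exact_mod_cast hx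
  simp only [Complex.star_def] at hn
  replace hn : (q 0 : ℂ) * (starRingEnd ℂ) (q 0) + q 1 * (starRingEnd ℂ) (q 1) = (q₀ : ℂ) ^ 2 := hn
  simp only [dotProduct, Fin.sum_univ_three, Pi.star_apply, colY, matY, normC]
  fin_cases l <;> fin_cases j <;> simp <;>
  · generalize (starRingEnd ℂ) (q 0) = a at *
    generalize (starRingEnd ℂ) (q 1) = b at *
    generalize (q 0 : ℂ) = c at *
    generalize (q 1 : ℂ) = d at *
    generalize (q₀ : ℂ) = e at *
    generalize (x : ℂ) = w at *
    generalize Complex.I = I at *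
    replace hn : c * a + d * b = e ^ 2 := hn
    grind

/-- The Wronskian is conserved, and its value is read off from the background columns in the limit
at `-∞` of the (possibly reflected) variable. -/
lemma jostCol_dotProduct_same (hε : ε * ε = 1) (hq : ‖q‖ = q₀) (h0 : q₀ ≠ 0)
    (hz : z ∈ realAxis) (hW : ∀ a, IntegrableOn (jostW ε q u) (Iic a))
    (hu : LocallyIntegrable fun x => u x - q) (l j : Fin 3) :
    star (jostCol ε q₀ q u l z 0) ⬝ᵥ jostCol ε q₀ q u j z 0 = if l = j then normC q₀ z j else 0 := by
  have hre : ∀ l, lam1 q₀ z l = ((lam1 q₀ z l).re : ℂ) := fun l =>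
    Complex.ext rfl (by simpa using lam1_im hz l)
  have hsol : ∀ l, IsODESol (fun r => matA (specK q₀ z) (u r)) ((lam1 q₀ z l).re : ℂ)
      fun x => jostCol ε q₀ q u l z (ε * x) := fun l => by
    rw [← hre l]; exact isODESol_jostCol hε hq h0 hz hW hu l
  have hw := fun y => (hsol l).wronskian (fun r => matA_conjTranspose hz (u r)) (hsol j) 0 y
  simp only [mul_zero, Complex.ofReal_zero, Complex.exp_zero, one_mul] at hw
  have hlim : ∀ j, Tendsto (jostCol ε q₀ q u j z) atBot (𝓝 (colY q₀ q j z)) := by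
    intro j
    obtain ⟨B, hB⟩ := exists_norm_jostKernel_le ε hq h0 hz j
    have hJ := isJostCol_jostCol hq h0 hz hW j
    obtain ⟨C, hC⟩ := hJ.bounded 0
    exact tendsto_volterra_atBot (fun s _ => hB s) hW hC hJ.volterra
  have hdot : Tendsto (fun x => star (jostCol ε q₀ q u l z x) ⬝ᵥ jostCol ε q₀ q u j z x) atBot
      (𝓝 (if l = j then normC q₀ z j else 0)) := by
    rw [← colY_dotProduct hq h0 hz l j]
    simp only [dotProduct]
    exact tendsto_finsetSum _ fun i _ => Tendsto.mul (M := ℂ)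
      ((tendsto_pi_nhds.1 (hlim l) i).star) (tendsto_pi_nhds.1 (hlim j) i)
  have hεε : ∀ y, ε * (ε * y) = y := fun y => by rw [← mul_assoc, hε, one_mul]
  by_cases hlj : l = j
  · subst hlj
    refine tendsto_nhds_unique tendsto_const_nhds (hdot.congr fun y => ?_)
    have := hw (ε * y)
    rw [hεε, sub_self, zero_mul, mul_zero, Complex.exp_zero, one_mul] at this
    exact this.symm
  -- For distinct columns the conserved quantity carries an oscillating factor of modulus one. The
  -- modulus of the product is thus constant, and it tends to zero.
  · rw [if_neg hlj] at hdot ⊢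
    have hdot' := hdot.norm
    rw [norm_zero] at hdot'
    rw [← norm_eq_zero]
    refine tendsto_nhds_unique tendsto_const_nhds (hdot'.congr fun y => ?_)
    have := hw (ε * y)
    rw [hεε] at this
    rw [this, norm_mul, Complex.norm_exp]
    simp

end RealAxis

/-! ### The scattering matrix on the real axis -/

/-- The standing assumptions on the potential at a fixed time. -/
structure IsPotential (q₀ : ℝ) (qm qp : V) (u : ℝ → V) : Prop where
  pos : 0 < q₀
  norm_minus : ‖qm‖ = q₀
  norm_plus : ‖qp‖ = q₀
  integrable_minus : ∀ a : ℝ, IntegrableOn (fun x => u x - qm) (Iio a)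
  integrable_plus : ∀ a : ℝ, IntegrableOn (fun x => u x - qp) (Ioi a)

lemma IsPotential.locallyIntegrable_minus {q₀ : ℝ} {qm qp : V} {u : ℝ → V}
    (h : IsPotential q₀ qm qp u) : LocallyIntegrable fun x => u x - qm :=
  fun x => ⟨Iio (x + 1), Iio_mem_nhds (by linarith), h.integrable_minus _⟩

lemma IsPotential.locallyIntegrable_plus {q₀ : ℝ} {qm qp : V} {u : ℝ → V}
    (h : IsPotential q₀ qm qp u) : LocallyIntegrable fun x => u x - qp :=
  fun x => ⟨Ioi (x - 1), Ioi_mem_nhds (by linarith), h.integrable_plus _⟩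

/-- The Jost eigenfunction `ψ₋` if `ε = 1` and `ψ₊` if `ε = -1`. -/
def psiMat (σ t ε q₀ : ℝ) (q : V) (u : ℝ → V) (z : ℂ) (x : ℝ) : M3 :=
  (Matrix.of fun i j => jostCol ε q₀ q u j z (ε * x) i) * expOmega σ q₀ x t z

lemma psiMat_dotProduct (σ t ε₁ ε₂ q₀ : ℝ) (q₁ q₂ : V) (u : ℝ → V) (z : ℂ) (x : ℝ)
    (l j : Fin 3) :
    ((psiMat σ t ε₁ q₀ q₁ u z x).conjTranspose * psiMat σ t ε₂ q₀ q₂ u z x) l j =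
      star (Complex.exp (Complex.I * phase σ q₀ x t z l)) *
        Complex.exp (Complex.I * phase σ q₀ x t z j) *
        (star (jostCol ε₁ q₀ q₁ u l z (ε₁ * x)) ⬝ᵥ jostCol ε₂ q₀ q₂ u j z (ε₂ * x)) := by
  have he : ∀ ε q i j, psiMat σ t ε q₀ q u z x i j =
      jostCol ε q₀ q u j z (ε * x) i * Complex.exp (Complex.I * phase σ q₀ x t z j) :=
    fun ε q i j => by rw [psiMat, expOmega, Matrix.mul_diagonal, Matrix.of_apply]
  simp only [Matrix.mul_apply, Matrix.conjTranspose_apply, he, dotProduct, Finset.mul_sum,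
    Pi.star_apply, star_mul']
  exact Finset.sum_congr rfl fun i _ => by ring

section RealAxis

variable {σ t q₀ : ℝ} {qm qp : V} {u : ℝ → V} {z : ℂ}

lemma phase_eq (σ q₀ x t : ℝ) (z : ℂ) (l : Fin 3) :
    phase σ q₀ x t z l = lam1 q₀ z l * x + phase σ q₀ 0 t z l := by
  fin_cases l <;> simp [phase, lam1]

lemma star_phase (hz : z ∈ realAxis) (x : ℝ) (l : Fin 3) :
    star (phase σ q₀ x t z l) = phase σ q₀ x t z l := by
  have hk : (starRingEnd ℂ) (specK q₀ z) = specK q₀ z := Complex.conj_eq_iff_im.2 (specK_im hz)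
  have hl : (starRingEnd ℂ) (specLam q₀ z) = specLam q₀ z :=
    Complex.conj_eq_iff_im.2 (lam1_im hz 2)
  fin_cases l <;> simp [phase, hk, hl]

lemma star_exp_phase (hz : z ∈ realAxis) (x : ℝ) (l : Fin 3) :
    star (Complex.exp (Complex.I * phase σ q₀ x t z l)) =
      Complex.exp (-(Complex.I * phase σ q₀ x t z l)) := by
  have h := star_phase (σ := σ) (t := t) (q₀ := q₀) hz x l
  rw [Complex.star_def] at h ⊢
  rw [← Complex.exp_conj, map_mul, Complex.conj_I, h, neg_mul]

/-- The `x`-dependence of the phases is `λ_l x`, exactly the exponential factor in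
`IsODESol.wronskian`. -/
lemma psiMat_conjTranspose_mul (hz : z ∈ realAxis) {ε₁ ε₂ : ℝ} {q₁ q₂ : V}
    (h₁ : ∀ j, IsODESol (fun r => matA (specK q₀ z) (u r)) (lam1 q₀ z j)
      fun x => jostCol ε₁ q₀ q₁ u j z (ε₁ * x))
    (h₂ : ∀ j, IsODESol (fun r => matA (specK q₀ z) (u r)) (lam1 q₀ z j)
      fun x => jostCol ε₂ q₀ q₂ u j z (ε₂ * x)) (x : ℝ) :
    (psiMat σ t ε₁ q₀ q₁ u z x).conjTranspose * psiMat σ t ε₂ q₀ q₂ u z x =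
      (psiMat σ t ε₁ q₀ q₁ u z 0).conjTranspose * psiMat σ t ε₂ q₀ q₂ u z 0 := by
  have hre : ∀ l, lam1 q₀ z l = ((lam1 q₀ z l).re : ℂ) := fun l =>
    Complex.ext rfl (by simpa using lam1_im hz l)
  ext l j
  rw [psiMat_dotProduct, psiMat_dotProduct, star_exp_phase hz, star_exp_phase hz, ← Complex.exp_add,
    ← Complex.exp_add]
  have hw := IsODESol.wronskian (fun r => matA_conjTranspose hz (u r))
    (by rw [← hre l]; exact h₁ l) (by rw [← hre j]; exact h₂ j) x 0
  rw [← hre l, ← hre j, Complex.ofReal_zero, mul_zero, mul_zero, Complex.exp_zero, one_mul] at hw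
  rw [← hw, ← mul_assoc, ← Complex.exp_add]
  congr 2
  rw [phase_eq σ q₀ x t z l, phase_eq σ q₀ x t z j]
  ring

/-- The scattering matrix `C⁻¹ ψ₊† ψ₋`. -/
def scatMat (σ t q₀ : ℝ) (qm qp : V) (u : ℝ → V) (z : ℂ) : M3 :=
  Matrix.diagonal (fun j => (normC q₀ z j)⁻¹) *
    ((psiMat σ t (-1) q₀ qp u z 0).conjTranspose * psiMat σ t 1 q₀ qm u z 0)

/-- The inverse scattering matrix `C⁻¹ ψ₋† ψ₊`. -/
def scatInv (σ t q₀ : ℝ) (qm qp : V) (u : ℝ → V) (z : ℂ) : M3 :=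
  Matrix.diagonal (fun j => (normC q₀ z j)⁻¹) *
    ((psiMat σ t 1 q₀ qm u z 0).conjTranspose * psiMat σ t (-1) q₀ qp u z 0)

lemma normC_ne_zero (hz : z ∈ realAxis) (j : Fin 3) : normC q₀ z j ≠ 0 := by
  have h := one_add_ne_zero (q₀ := q₀) hz
  fin_cases j <;> simp [normC, h]

lemma psiMat_same (hz : z ∈ realAxis) {ε : ℝ} (hε : ε * ε = 1) {q : V} (hq : ‖q‖ = q₀)
    (h0 : q₀ ≠ 0) (hW : ∀ a, IntegrableOn (jostW ε q u) (Iic a))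
    (hu : LocallyIntegrable fun x => u x - q) (x : ℝ) :
    Matrix.diagonal (fun j => (normC q₀ z j)⁻¹) *
      ((psiMat σ t ε q₀ q u z x).conjTranspose * psiMat σ t ε q₀ q u z x) = 1 := by
  have h := isODESol_jostCol hε hq h0 hz hW hu
  rw [psiMat_conjTranspose_mul hz h h]
  ext l j
  rw [Matrix.diagonal_mul, psiMat_dotProduct, mul_zero,
    jostCol_dotProduct_same hε hq h0 hz hW hu l j, star_exp_phase hz, ← Complex.exp_add]
  by_cases hlj : l = j
  · subst hlj
    simp [normC_ne_zero hz]
  · simp [hlj]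

lemma psiMat_mul_same (hz : z ∈ realAxis) {ε : ℝ} (hε : ε * ε = 1) {q : V} (hq : ‖q‖ = q₀)
    (h0 : q₀ ≠ 0) (hW : ∀ a, IntegrableOn (jostW ε q u) (Iic a))
    (hu : LocallyIntegrable fun x => u x - q) (x : ℝ) :
    psiMat σ t ε q₀ q u z x * (Matrix.diagonal (fun j => (normC q₀ z j)⁻¹) *
      (psiMat σ t ε q₀ q u z x).conjTranspose) = 1 := by
  rw [mul_eq_one_comm, Matrix.mul_assoc]
  exact psiMat_same hz hε hq h0 hW hu x

variable (h : IsPotential q₀ qm qp u)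
include h

/-- Since `C⁻¹ψ₋†` is the inverse of `ψ₋`, the middle factor `ψ₋C⁻¹ψ₋†` drops out and `C⁻¹ψ₊†ψ₊ = 1`
is left. -/
lemma scatMat_mul_scatInv (hz : z ∈ realAxis) :
    scatMat σ t q₀ qm qp u z * scatInv σ t q₀ qm qp u z = 1 := by
  have h1 := psiMat_mul_same (σ := σ) (t := t) hz (one_mul 1) h.norm_minus h.pos.ne'
    (integrableOn_jostW_minus h.integrable_minus) h.locallyIntegrable_minus 0
  have h2 := psiMat_same (σ := σ) (t := t) hz (by norm_num : (-1 : ℝ) * -1 = 1) h.norm_plus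
    h.pos.ne' (integrableOn_jostW_plus h.integrable_plus) h.locallyIntegrable_plus 0
  rw [scatMat, scatInv]
  set M := psiMat σ t 1 q₀ qm u z 0
  set P := psiMat σ t (-1) q₀ qp u z 0
  set D : M3 := Matrix.diagonal (fun j => (normC q₀ z j)⁻¹)
  calc D * (P.conjTranspose * M) * (D * (M.conjTranspose * P))
      = D * (P.conjTranspose * ((M * (D * M.conjTranspose)) * P)) := by noncomm_ring
    _ = 1 := by rw [h1, one_mul, h2]

/-- Multiplying `ψ₋ = ψ₊S` at `x = 0` by `C⁻¹ψ₊†` determines `S`. Conversely, `ψ₊†ψ₋` is independent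
of `x`, so the same matrix works at every `x`. -/
lemma isScatteringMatrix_iff (hz : z ∈ realAxis) {S : M3} :
    IsScatteringMatrix σ q₀ qm qp u t z S ↔ S = scatMat σ t q₀ qm qp u z := by
  have h2 := psiMat_same (σ := σ) (t := t) hz (by norm_num : (-1 : ℝ) * -1 = 1) h.norm_plus
    h.pos.ne' (integrableOn_jostW_plus h.integrable_plus) h.locallyIntegrable_plus
  have h3 := psiMat_mul_same (σ := σ) (t := t) hz (by norm_num : (-1 : ℝ) * -1 = 1) h.norm_plus
    h.pos.ne' (integrableOn_jostW_plus h.integrable_plus) h.locallyIntegrable_plus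
  have hm := isODESol_jostCol (one_mul 1) h.norm_minus h.pos.ne' hz
    (integrableOn_jostW_minus h.integrable_minus) h.locallyIntegrable_minus
  have hp := isODESol_jostCol (by norm_num : (-1 : ℝ) * -1 = 1) h.norm_plus h.pos.ne' hz
    (integrableOn_jostW_plus h.integrable_plus) h.locallyIntegrable_plus
  constructor
  · rintro ⟨νm, νp, hνm, hνp, hS⟩
    rw [isJostMinus_iff h.norm_minus h.pos.ne' hz (integrableOn_jostW_minus h.integrable_minus)]
      at hνm
    rw [isJostPlus_iff h.norm_plus h.pos.ne' hz (integrableOn_jostW_plus h.integrable_plus)]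
      at hνp
    have e1 : νm 0 = Matrix.of fun i j => jostCol 1 q₀ qm u j z (1 * 0) i := by
      ext i j; rw [hνm, Matrix.of_apply, one_mul]
    have e2 : νp 0 = Matrix.of fun i j => jostCol (-1) q₀ qp u j z (-1 * 0) i := by
      ext i j; rw [hνp, Matrix.of_apply, neg_one_mul]
    have h4 := hS 0
    rw [e1, e2] at h4
    change psiMat σ t 1 q₀ qm u z 0 = psiMat σ t (-1) q₀ qp u z 0 * S at h4
    rw [scatMat, h4, ← Matrix.mul_assoc, ← Matrix.mul_assoc, Matrix.mul_assoc (Matrix.diagonal _),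
      h2, one_mul]
  · rintro rfl
    refine ⟨fun x => Matrix.of fun i j => jostCol 1 q₀ qm u j z (1 * x) i,
      fun x => Matrix.of fun i j => jostCol (-1) q₀ qp u j z (-1 * x) i, ?_, ?_, fun x => ?_⟩
    · rw [isJostMinus_iff h.norm_minus h.pos.ne' hz (integrableOn_jostW_minus h.integrable_minus)]
      intro x i j; rw [Matrix.of_apply, one_mul]
    · rw [isJostPlus_iff h.norm_plus h.pos.ne' hz (integrableOn_jostW_plus h.integrable_plus)]
      intro x i j; rw [Matrix.of_apply, neg_one_mul]
    · change psiMat σ t 1 q₀ qm u z x = psiMat σ t (-1) q₀ qp u z x * scatMat σ t q₀ qm qp u z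
      rw [scatMat, ← psiMat_conjTranspose_mul hz hp hm x, ← Matrix.mul_assoc, ← Matrix.mul_assoc,
        Matrix.mul_assoc (psiMat σ t (-1) q₀ qp u z x), h3, one_mul]

omit h

/-- The extension of `s_jj` to complex `z`. -/
def sCoef (q₀ : ℝ) (qm qp : V) (u : ℝ → V) (j : Fin 3) (z : ℂ) : ℂ :=
  (normC q₀ z j)⁻¹ * (star (jostCol (-1) q₀ qp u j (star z) 0) ⬝ᵥ jostCol 1 q₀ qm u j z 0)

/-- The extension of `h_jj` to complex `z`. -/
def hCoef (q₀ : ℝ) (qm qp : V) (u : ℝ → V) (j : Fin 3) (z : ℂ) : ℂ :=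
  star (sCoef q₀ qm qp u j (star z))

lemma star_of_mem_realAxis (hz : z ∈ realAxis) : star z = z := Complex.conj_eq_iff_im.2 hz.1

/-- On the diagonal `e^{-iδ_j}` meets `e^{iδ_j}`, so the explicit `σ` and `t` disappear. -/
lemma scatMat_diag (hz : z ∈ realAxis) (j : Fin 3) :
    scatMat σ t q₀ qm qp u z j j = sCoef q₀ qm qp u j z := by
  rw [scatMat, Matrix.diagonal_mul, psiMat_dotProduct, star_exp_phase hz, ← Complex.exp_add,
    neg_add_cancel, Complex.exp_zero, one_mul, mul_zero, mul_zero, sCoef, star_of_mem_realAxis hz]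

lemma star_normC (q₀ : ℝ) (z : ℂ) (j : Fin 3) : star (normC q₀ z j) = normC q₀ (star z) j := by
  fin_cases j <;> simp [normC]

lemma scatInv_diag (hz : z ∈ realAxis) (j : Fin 3) :
    scatInv σ t q₀ qm qp u z j j = hCoef q₀ qm qp u j z := by
  rw [scatInv, Matrix.diagonal_mul, psiMat_dotProduct, star_exp_phase hz, ← Complex.exp_add,
    neg_add_cancel, Complex.exp_zero, one_mul, mul_zero, mul_zero, hCoef, sCoef,
    star_of_mem_realAxis hz, star_of_mem_realAxis hz, star_mul', star_inv₀, star_normC,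
    star_of_mem_realAxis hz, ← Matrix.star_dotProduct]

end RealAxis

/-! ### The symmetry `z ↦ -q₀²/z` -/

section Symmetry

variable {q₀ : ℝ} {q qm qp : V} {u : ℝ → V} {z : ℂ}

lemma specK_symm (h0 : q₀ ≠ 0) (hz : z ≠ 0) : specK q₀ (-(q₀ : ℂ) ^ 2 / z) = specK q₀ z := by
  have h0' : (q₀ : ℂ) ≠ 0 := by exact_mod_cast h0
  rw [specK, specK]; field_simp; ring

lemma specLam_symm (h0 : q₀ ≠ 0) (hz : z ≠ 0) :
    specLam q₀ (-(q₀ : ℂ) ^ 2 / z) = -specLam q₀ z := by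
  have h0' : (q₀ : ℂ) ≠ 0 := by exact_mod_cast h0
  rw [specLam, specLam]; field_simp; ring

/-- Generator and normalization of the second column involve `z` only through `k`, which is
invariant. -/
lemma jostCol_one_symm (ε : ℝ) (h0 : q₀ ≠ 0) (hz : z ≠ 0) :
    jostCol ε q₀ q u 1 (-(q₀ : ℂ) ^ 2 / z) = jostCol ε q₀ q u 1 z := by
  have h1 : gen q₀ q 1 (-(q₀ : ℂ) ^ 2 / z) = gen q₀ q 1 z := by
    simp [gen, lam1, specK_symm h0 hz]
  have h2 : colY q₀ q 1 (-(q₀ : ℂ) ^ 2 / z) = colY q₀ q 1 z := by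
    funext i; fin_cases i <;> simp [colY, matY]
  have h3 : jostKernel ε q₀ q 1 (-(q₀ : ℂ) ^ 2 / z) = jostKernel ε q₀ q 1 z := by
    funext s; rw [jostKernel, jostKernel, h1]
  rw [jostCol, jostCol, h2, h3]

/-- As `λ` changes sign, the generator of the first column at the image point is that of the third
column at `z`; the normalizations differ by the scalar `iz/q₀`. -/
lemma jostCol_zero_symm (ε : ℝ) (h0 : q₀ ≠ 0) (hz : z ≠ 0) (x : ℝ) :
    jostCol ε q₀ q u 0 (-(q₀ : ℂ) ^ 2 / z) x = (Complex.I * z / q₀) • jostCol ε q₀ q u 2 z x := by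
  have h0' : (q₀ : ℂ) ≠ 0 := by exact_mod_cast h0
  have h1 : gen q₀ q 0 (-(q₀ : ℂ) ^ 2 / z) = gen q₀ q 2 z := by
    simp [gen, lam1, specK_symm h0 hz, specLam_symm h0 hz]
  have h2 : colY q₀ q 0 (-(q₀ : ℂ) ^ 2 / z) = (Complex.I * z / q₀) • colY q₀ q 2 z := by
    have hI := Complex.I_mul_I
    funext i
    fin_cases i <;> simp [colY, matY] <;> field_simp
    linear_combination hI
  have h3 : jostKernel ε q₀ q 0 (-(q₀ : ℂ) ^ 2 / z) = jostKernel ε q₀ q 2 z := by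
    funext s; rw [jostKernel, jostKernel, h1]
  rw [jostCol, jostCol, h2, h3, volterraSol_smul]

lemma star_symm (q₀ : ℝ) (z : ℂ) :
    star (-(q₀ : ℂ) ^ 2 / z) = -(q₀ : ℂ) ^ 2 / star z := by simp

lemma sCoef_one_symm (h0 : q₀ ≠ 0) (hz : z ≠ 0) :
    sCoef q₀ qm qp u 1 (-(q₀ : ℂ) ^ 2 / z) = sCoef q₀ qm qp u 1 z := by
  rw [sCoef, sCoef, star_symm, jostCol_one_symm _ h0 hz, jostCol_one_symm _ h0 (star_ne_zero.2 hz)]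
  simp [normC]

/-- The two column factors multiply to `z²/q₀²` because the conjugated one is taken at `z*`. The
normalization constant acquires the same factor, so they cancel. -/
lemma sCoef_zero_symm (h0 : q₀ ≠ 0) (hz : z ≠ 0) :
    sCoef q₀ qm qp u 0 (-(q₀ : ℂ) ^ 2 / z) = sCoef q₀ qm qp u 2 z := by
  have h0' : (q₀ : ℂ) ≠ 0 := by exact_mod_cast h0
  have h1 : normC q₀ (-(q₀ : ℂ) ^ 2 / z) 0 = z ^ 2 / q₀ ^ 2 * normC q₀ z 2 := by
    simp only [normC, Matrix.cons_val]
    field_simp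
    ring
  have h2 : star (Complex.I * star z / (q₀ : ℂ)) * (Complex.I * z / q₀) = z ^ 2 / q₀ ^ 2 := by
    simp only [star_div₀, star_mul', Complex.star_def, Complex.conj_conj, Complex.conj_I,
      Complex.conj_ofReal]
    field_simp
    rw [Complex.I_sq]; ring
  rw [sCoef, sCoef, star_symm, jostCol_zero_symm _ h0 hz,
    jostCol_zero_symm _ h0 (star_ne_zero.2 hz), h1, star_smul, smul_dotProduct, dotProduct_smul,
    smul_eq_mul, smul_eq_mul, ← mul_assoc (star _), h2, mul_inv]
  have h3 : z ^ 2 / (q₀ : ℂ) ^ 2 ≠ 0 := div_ne_zero (pow_ne_zero 2 hz) (pow_ne_zero 2 h0')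
  field_simp

end Symmetry

lemma differentiableAt_star_comp_star {f : ℂ → ℂ} {z : ℂ} (hf : DifferentiableAt ℂ f (star z)) :
    DifferentiableAt ℂ (fun z => star (f (star z))) z := by
  have h := DifferentiableAt.star_star hf
  rwa [star_star] at h

/-! ### Geometry of the domains of analyticity -/

section Domains

variable {q₀ : ℝ} {z : ℂ}

lemma specLam_star (q₀ : ℝ) (z : ℂ) : specLam q₀ (star z) = star (specLam q₀ z) := by
  simp [specLam]

lemma specK_star (q₀ : ℝ) (z : ℂ) : specK q₀ (star z) = star (specK q₀ z) := by
  simp [specK]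

lemma lam1_star (q₀ : ℝ) (z : ℂ) (l : Fin 3) : lam1 q₀ (star z) l = star (lam1 q₀ z l) := by
  fin_cases l <;> simp [lam1, ← specLam_star, ← specK_star, -RCLike.star_def]

/-- Conjugation and `ε ↦ -ε` both flip the sign of the condition. Hence `ν₊` at `z*` is controlled
wherever `ν₋` at `z` is. -/
lemma star_mem_admissible {ε : ℝ} {j : Fin 3} (hz : z ∈ admissible ε q₀ j) :
    star z ∈ admissible (-ε) q₀ j := by
  refine ⟨star_ne_zero.2 hz.1, fun l => ?_⟩
  have h := hz.2 l
  rw [lam1_star, lam1_star, ← star_sub, Complex.star_def, Complex.conj_im]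
  linarith

lemma sq_div_im (q₀ : ℝ) (z : ℂ) : ((q₀ : ℂ) ^ 2 / z).im = -(q₀ ^ 2 * z.im / ‖z‖ ^ 2) := by
  rw [← Complex.ofReal_pow, div_eq_mul_inv, Complex.im_ofReal_mul, Complex.inv_im,
    Complex.normSq_eq_norm_sq]
  ring

/-- The differences `λ_l - λ_1` are `0`, `z` and `z + q₀²/z`, and the last has imaginary part `Im z
(1 - q₀²/|z|²)`. -/
lemma mem_admissible_zero (hz : z ≠ 0) (him : 0 ≤ z.im) (hn : q₀ ^ 2 ≤ ‖z‖ ^ 2) :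
    z ∈ admissible 1 q₀ 0 := by
  have hpos : 0 < ‖z‖ ^ 2 := by positivity
  refine ⟨hz, fun l => ?_⟩
  have h : q₀ ^ 2 * z.im / ‖z‖ ^ 2 ≤ z.im := by
    rw [div_le_iff₀ hpos, mul_comm]; gcongr
  fin_cases l
  · simp
  · have : lam1 q₀ z 1 - lam1 q₀ z 0 = z := by
      simp only [lam1, specK, specLam, Matrix.cons_val]; ring
    simpa [this] using him
  · have : lam1 q₀ z 2 - lam1 q₀ z 0 = z + (q₀ : ℂ) ^ 2 / z := by
      simp only [lam1, specLam, Matrix.cons_val]; ring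
    rw [one_mul]
    change 0 ≤ (lam1 q₀ z 2 - lam1 q₀ z 0).im
    rw [this, Complex.add_im, sq_div_im]
    linarith

lemma mem_admissible_two (hz : z ≠ 0) (him : 0 ≤ z.im) (hn : ‖z‖ ^ 2 ≤ q₀ ^ 2) :
    z ∈ admissible 1 q₀ 2 := by
  have hpos : 0 < ‖z‖ ^ 2 := by positivity
  refine ⟨hz, fun l => ?_⟩
  have h : z.im ≤ q₀ ^ 2 * z.im / ‖z‖ ^ 2 := by
    rw [le_div_iff₀ hpos, mul_comm]; gcongr
  have h' : 0 ≤ q₀ ^ 2 * z.im / ‖z‖ ^ 2 := by positivity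
  rw [one_mul]
  fin_cases l
  · have : lam1 q₀ z 0 - lam1 q₀ z 2 = -z - (q₀ : ℂ) ^ 2 / z := by
      simp only [lam1, specLam, Matrix.cons_val]; ring
    change 0 ≤ (lam1 q₀ z 0 - lam1 q₀ z 2).im
    rw [this, Complex.sub_im, Complex.neg_im, sq_div_im]
    linarith
  · have : lam1 q₀ z 1 - lam1 q₀ z 2 = -((q₀ : ℂ) ^ 2 / z) := by
      simp only [lam1, specK, specLam, Matrix.cons_val]; ring
    change 0 ≤ (lam1 q₀ z 1 - lam1 q₀ z 2).im
    rw [this, Complex.neg_im, sq_div_im]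
    linarith
  · simp

/-- Here the differences are `-z`, `0` and `q₀²/z`, so the modulus of `z` plays no role and the
whole half-plane is admissible. -/
lemma mem_admissible_one (hz : z ≠ 0) (him : z.im ≤ 0) : z ∈ admissible 1 q₀ 1 := by
  refine ⟨hz, fun l => ?_⟩
  have h' : 0 ≤ q₀ ^ 2 * (-z.im) / ‖z‖ ^ 2 :=
    div_nonneg (mul_nonneg (by positivity) (by linarith)) (by positivity)
  rw [one_mul]
  fin_cases l
  · have : lam1 q₀ z 0 - lam1 q₀ z 1 = -z := by
      simp only [lam1, specK, specLam, Matrix.cons_val]; ring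
    change 0 ≤ (lam1 q₀ z 0 - lam1 q₀ z 1).im
    rw [this, Complex.neg_im]
    linarith
  · simp
  · have : lam1 q₀ z 2 - lam1 q₀ z 1 = (q₀ : ℂ) ^ 2 / z := by
      simp only [lam1, specK, specLam, Matrix.cons_val]; ring
    change 0 ≤ (lam1 q₀ z 2 - lam1 q₀ z 1).im
    rw [this, sq_div_im]
    have : -(q₀ ^ 2 * z.im / ‖z‖ ^ 2) = q₀ ^ 2 * (-z.im) / ‖z‖ ^ 2 := by ring
    linarith

lemma one_add_ne_zero_of_norm_ne (h0 : 0 < q₀) (hz : z ≠ 0) (hn : ‖z‖ ≠ q₀) :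
    1 + (q₀ : ℂ) ^ 2 / z ^ 2 ≠ 0 := by
  intro h
  apply hn
  have hsq : z ^ 2 = -(q₀ : ℂ) ^ 2 := by
    field_simp at h
    linear_combination h
  have := congrArg norm hsq
  rw [norm_neg, norm_pow, norm_pow, Complex.norm_real, Real.norm_of_nonneg h0.le] at this
  exact (pow_left_inj₀ (norm_nonneg _) h0.le two_ne_zero).1 this

lemma isOpen_upper : IsOpen upper := isOpen_lt continuous_const Complex.continuous_im
lemma isOpen_lower : IsOpen lower := isOpen_lt Complex.continuous_im continuous_const
lemma isOpen_U1 (q₀ : ℝ) : IsOpen (U1 q₀) :=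
  isOpen_upper.inter (isOpen_lt continuous_const continuous_norm)
lemma isOpen_U4 (q₀ : ℝ) : IsOpen (U4 q₀) :=
  isOpen_upper.inter (isOpen_lt continuous_norm continuous_const)

lemma isPreconnected_upper : IsPreconnected upper :=
  (convex_halfSpace_im_gt 0).isPreconnected

lemma isPreconnected_U4 (q₀ : ℝ) : IsPreconnected (U4 q₀) := by
  have h : U4 q₀ = {z : ℂ | 0 < z.im} ∩ Metric.ball 0 q₀ := by
    ext z; simp [U4]
  rw [h]
  exact ((convex_halfSpace_im_gt 0).inter (convex_ball _ _)).isPreconnected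

lemma symm_im (q₀ : ℝ) (z : ℂ) : (-(q₀ : ℂ) ^ 2 / z).im = q₀ ^ 2 * z.im / ‖z‖ ^ 2 := by
  rw [neg_div, Complex.neg_im, sq_div_im, neg_neg]

lemma norm_symm (q₀ : ℝ) (z : ℂ) : ‖-(q₀ : ℂ) ^ 2 / z‖ = q₀ ^ 2 / ‖z‖ := by
  rw [norm_div, norm_neg, norm_pow, Complex.norm_real, Real.norm_eq_abs, sq_abs]

lemma ne_zero_of_im_pos (h : 0 < z.im) : z ≠ 0 := fun h0 => by simp [h0] at h

lemma symm_symm (h0 : q₀ ≠ 0) (hz : z ≠ 0) : -(q₀ : ℂ) ^ 2 / (-(q₀ : ℂ) ^ 2 / z) = z := by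
  have h0' : (q₀ : ℂ) ≠ 0 := by exact_mod_cast h0
  field_simp

lemma symm_im_pos (h0 : q₀ ≠ 0) (h : 0 < z.im) : 0 < (-(q₀ : ℂ) ^ 2 / z).im := by
  rw [symm_im]
  have := norm_pos_iff.2 (ne_zero_of_im_pos h)
  positivity

lemma symm_mem_U4 (h0 : 0 < q₀) (hz : z ∈ U1 q₀) : -(q₀ : ℂ) ^ 2 / z ∈ U4 q₀ := by
  refine ⟨symm_im_pos h0.ne' hz.1, ?_⟩
  rw [norm_symm, div_lt_iff₀ (h0.trans hz.2), sq]
  exact mul_lt_mul_of_pos_left hz.2 h0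

lemma symm_mem_U1 (h0 : 0 < q₀) (hz : z ∈ U4 q₀) : -(q₀ : ℂ) ^ 2 / z ∈ U1 q₀ := by
  refine ⟨symm_im_pos h0.ne' hz.1, ?_⟩
  rw [norm_symm, lt_div_iff₀ (norm_pos_iff.2 (ne_zero_of_im_pos hz.1)), sq]
  exact mul_lt_mul_of_pos_left hz.2 h0

/-- `U1` is not convex, but it is the image under `z ↦ -q₀²/z` of the convex half-disc `U4`. -/
lemma isPreconnected_U1 (h0 : 0 < q₀) : IsPreconnected (U1 q₀) := by
  have h : U1 q₀ = (fun z : ℂ => -(q₀ : ℂ) ^ 2 / z) '' U4 q₀ := by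
    ext z
    refine ⟨fun hz => ⟨_, symm_mem_U4 h0 hz, symm_symm h0.ne' (ne_zero_of_im_pos hz.1)⟩, ?_⟩
    rintro ⟨w, hw, rfl⟩
    exact symm_mem_U1 h0 hw
  rw [h]
  exact (isPreconnected_U4 q₀).image _
    (continuousOn_const.div continuousOn_id fun z hz => ne_zero_of_im_pos hz.1)

end Domains

/-! ### Regularity, boundary values and uniqueness of the coefficients -/

section Coefficients

variable {σ t q₀ : ℝ} {qm qp : V} {u : ℝ → V}

lemma differentiableOn_normC (q₀ : ℝ) (j : Fin 3) :
    DifferentiableOn ℂ (fun z => normC q₀ z j) {0}ᶜ := by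
  have h : DifferentiableOn ℂ (fun z : ℂ => 1 + (q₀ : ℂ) ^ 2 / z ^ 2) {0}ᶜ :=
    ((differentiableOn_const _).div (differentiableOn_id.pow 2)
      fun z hz => pow_ne_zero 2 hz).const_add _
  fin_cases j
  · exact h
  · exact differentiableOn_const _
  · exact h

/-- Both columns are regular in `z`: the `ν₋` column directly, and the conjugate of the `ν₊` column
at `z*` by Schwarz reflection. -/
lemma sCoef_regular (h : IsPotential q₀ qm qp u) {j : Fin 3} {D S : Set ℂ} (hD : IsOpen D)
    (hDS : D ⊆ S) (hS : S ⊆ admissible 1 q₀ j)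
    (hint : ∀ z ∈ S, 1 + (q₀ : ℂ) ^ 2 / z ^ 2 ≠ 0 ∨ z ∈ D) (hC : ∀ z ∈ S, normC q₀ z j ≠ 0) :
    ContinuousOn (sCoef q₀ qm qp u j) S ∧ DifferentiableOn ℂ (sCoef q₀ qm qp u j) D := by
  have hS0 : S ⊆ {0}ᶜ := fun z hz => (hS hz).1
  obtain ⟨hmc, hmd⟩ := jostCol_parameter h.norm_minus h.pos
    (integrableOn_jostW_minus h.integrable_minus) hD hDS hS hint 0
  have hint' : ∀ z ∈ star ⁻¹' S, 1 + (q₀ : ℂ) ^ 2 / z ^ 2 ≠ 0 ∨ z ∈ star ⁻¹' D := by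
    intro z hz
    refine (hint (star z) hz).imp_left fun h1 h2 => h1 ?_
    have := congrArg star h2
    simpa using this
  obtain ⟨hpc, hpd⟩ := jostCol_parameter (S := star ⁻¹' S) h.norm_plus h.pos
    (integrableOn_jostW_plus h.integrable_plus) (hD.preimage continuous_star) (preimage_mono hDS)
    (fun z hz => star_star z ▸ star_mem_admissible (hS hz)) hint' 0
  have hpc' : ∀ i, ContinuousOn (fun z => star (jostCol (-1) q₀ qp u j (star z) 0 i)) S := fun i =>
    continuous_star.comp_continuousOn ((continuousOn_pi.1 hpc i).comp continuous_star.continuousOn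
      fun z hz => by simpa using hz)
  have hpd' : ∀ i, DifferentiableOn ℂ (fun z => star (jostCol (-1) q₀ qp u j (star z) 0 i)) D := by
    intro i z hz
    have h1 := (differentiableOn_pi.1 hpd i (star z) (by simpa using hz)).differentiableAt
      ((hD.preimage continuous_star).mem_nhds (by simpa using hz))
    exact (differentiableAt_star_comp_star h1).differentiableWithinAt
  constructor
  · refine ContinuousOn.mul (((differentiableOn_normC q₀ j).continuousOn.mono hS0).inv₀ hC) ?_
    exact continuousOn_finsetSum _ fun i _ => (hpc' i).mul (continuousOn_pi.1 hmc i)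
  · refine DifferentiableOn.mul (((differentiableOn_normC q₀ j).mono (hDS.trans hS0)).inv
      fun z hz => hC z (hDS hz)) ?_
    exact DifferentiableOn.fun_sum fun i _ => (hpd' i).mul (differentiableOn_pi.1 hmd i)

lemma isSCoeff_sCoef (h : IsPotential q₀ qm qp u) {j : Fin 3} {D B : Set ℂ} (hD : IsOpen D)
    (hB : B ⊆ realAxis) (hS : D ⊆ admissible 1 q₀ j)
    (hC : ∀ z ∈ D, normC q₀ z j ≠ 0) :
    IsSCoeff σ q₀ qm qp u t j D B (sCoef q₀ qm qp u j) := by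
  -- Points of `D` are interior, so `±iq₀` is allowed there; at real points `Y` is invertible.
  obtain ⟨hc, hd⟩ := sCoef_regular h (S := D ∪ B) hD subset_union_left
    (union_subset hS (hB.trans (realAxis_subset_admissible 1 j)))
    (fun z hz => hz.symm.imp_left fun hz => one_add_ne_zero (hB hz))
    (fun z hz => hz.elim (hC z) fun hz => normC_ne_zero (hB hz) j)
  exact ⟨hd.analyticOnNhd hD, hc, fun z hz =>
    ⟨_, (isScatteringMatrix_iff h (hB hz)).2 rfl, (scatMat_diag (hB hz) j).symm⟩⟩

lemma isHCoeff_hCoef (h : IsPotential q₀ qm qp u) {j : Fin 3} {D B : Set ℂ} (hD : IsOpen D)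
    (hB : B ⊆ realAxis) (hS : star ⁻¹' D ⊆ admissible 1 q₀ j)
    (hC : ∀ z, star z ∈ D → normC q₀ z j ≠ 0) :
    IsHCoeff σ q₀ qm qp u t j D B (hCoef q₀ qm qp u j) := by
  have hs := isSCoeff_sCoef (σ := σ) (t := t) h (hD.preimage continuous_star) hB hS hC
  have hd : DifferentiableOn ℂ (hCoef q₀ qm qp u j) D := by
    intro z hz
    have h1 : DifferentiableAt ℂ (sCoef q₀ qm qp u j) (star z) :=
      (hs.analytic (star z) (by simpa using hz)).differentiableAt
    exact (differentiableAt_star_comp_star h1).differentiableWithinAt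
  refine ⟨hd.analyticOnNhd hD, ?_, fun z hz => ?_⟩
  · refine continuous_star.comp_continuousOn (hs.continuousOn.comp continuous_star.continuousOn ?_)
    rintro z (hz | hz)
    · exact Or.inl (by simpa using hz)
    · exact Or.inr (by rwa [star_of_mem_realAxis (hB hz)])
  · have hmul := scatMat_mul_scatInv (σ := σ) (t := t) h (hB hz)
    refine ⟨_, (isScatteringMatrix_iff h (hB hz)).2 rfl,
      Matrix.isUnit_det_of_right_inverse hmul, ?_⟩
    rw [Matrix.inv_eq_right_inv hmul, scatInv_diag (hB hz)]

lemma IsSCoeff.eq_sCoef (h : IsPotential q₀ qm qp u) {j : Fin 3} {D B : Set ℂ} {F : ℂ → ℂ}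
    (hB : B ⊆ realAxis) (hF : IsSCoeff σ q₀ qm qp u t j D B F) {z : ℂ} (hz : z ∈ B) :
    F z = sCoef q₀ qm qp u j z := by
  obtain ⟨S, hS, hFS⟩ := hF.boundary z hz
  rw [hFS, (isScatteringMatrix_iff h (hB hz)).1 hS, scatMat_diag (hB hz)]

lemma IsHCoeff.eq_hCoef (h : IsPotential q₀ qm qp u) {j : Fin 3} {D B : Set ℂ} {F : ℂ → ℂ}
    (hB : B ⊆ realAxis) (hF : IsHCoeff σ q₀ qm qp u t j D B F) {z : ℂ} (hz : z ∈ B) :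
    F z = hCoef q₀ qm qp u j z := by
  obtain ⟨S, hS, -, hFS⟩ := hF.boundary z hz
  rw [hFS, (isScatteringMatrix_iff h (hB hz)).1 hS,
    Matrix.inv_eq_right_inv (scatMat_mul_scatInv h (hB hz)), scatInv_diag (hB hz)]

/-- Two functions holomorphic on `D` with the same real boundary values agree; the case of a domain
in the upper half-plane. -/
lemma eqOn_of_real_boundary {f g : ℂ → ℂ} {D B : Set ℂ} (hDc : IsPreconnected D)
    (hf : AnalyticOnNhd ℂ f D) (hg : AnalyticOnNhd ℂ g D) (hfc : ContinuousOn f (D ∪ B))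
    (hgc : ContinuousOn g (D ∪ B)) (h0 : ∀ z ∈ B, f z = g z) {p ρ : ℝ} (hρ : 0 < ρ)
    (hD : ∀ z : ℂ, ‖z - p‖ < ρ → 0 < z.im → z ∈ D)
    (hB : ∀ z : ℂ, ‖z - p‖ < ρ → z.im = 0 → z ∈ B) : EqOn f g D := fun _ hz =>
  sub_eq_zero.1 (eqOn_zero_of_real_boundary (f := fun z => f z - g z) hDc (hf.sub hg)
    (hfc.sub hgc) (fun z hz => sub_eq_zero.2 (h0 z hz)) hρ hD hB hz)

/-- The same for a domain in the lower half-plane. -/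
lemma eqOn_of_real_boundary_star {f g : ℂ → ℂ} {D B : Set ℂ} (hDo : IsOpen D)
    (hDc : IsPreconnected (star ⁻¹' D)) (hBr : B ⊆ realAxis)
    (hf : AnalyticOnNhd ℂ f D) (hg : AnalyticOnNhd ℂ g D) (hfc : ContinuousOn f (D ∪ B))
    (hgc : ContinuousOn g (D ∪ B)) (h0 : ∀ z ∈ B, f z = g z) {p ρ : ℝ} (hρ : 0 < ρ)
    (hD : ∀ z : ℂ, ‖z - p‖ < ρ → 0 < z.im → star z ∈ D)
    (hB : ∀ z : ℂ, ‖z - p‖ < ρ → z.im = 0 → z ∈ B) : EqOn f g D := by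
  have han : ∀ {f : ℂ → ℂ}, AnalyticOnNhd ℂ f D →
      AnalyticOnNhd ℂ (fun z => star (f (star z))) (star ⁻¹' D) := fun hf =>
    DifferentiableOn.analyticOnNhd (fun z hz =>
      (differentiableAt_star_comp_star (hf (star z) hz).differentiableAt).differentiableWithinAt)
      (hDo.preimage continuous_star)
  have hco : ∀ {f : ℂ → ℂ}, ContinuousOn f (D ∪ B) →
      ContinuousOn (fun z => star (f (star z))) (star ⁻¹' D ∪ B) := by
    intro f hf
    refine continuous_star.comp_continuousOn (hf.comp continuous_star.continuousOn ?_)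
    rintro z (hz | hz)
    · exact Or.inl hz
    · exact Or.inr (by rwa [star_of_mem_realAxis (hBr hz)])
  intro z hz
  have h1 := eqOn_of_real_boundary hDc (han hf) (han hg) (hco hfc) (hco hgc)
    (fun z hz => by rw [star_of_mem_realAxis (hBr hz), h0 z hz]) hρ hD hB
    (show star z ∈ star ⁻¹' D by simpa using hz)
  simp only [star_star] at h1
  exact star_injective h1

end Coefficients

/-! ### Existence and uniqueness of all six coefficients -/

section Assembly

variable {σ t q₀ : ℝ} {qm qp : V} {u : ℝ → V}

lemma realOuter_subset (h0 : 0 < q₀) : realOuter q₀ ⊆ realAxis :=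
  fun _ hz => ⟨hz.1, norm_pos_iff.1 (h0.trans hz.2)⟩

lemma realInner_subset (q₀ : ℝ) : realInner q₀ ⊆ realAxis := fun _ hz => ⟨hz.1, hz.2.1⟩

lemma star_preimage_U2 (q₀ : ℝ) : star ⁻¹' U2 q₀ = U1 q₀ := by
  ext z; simp [U1, U2]

lemma star_preimage_U3 (q₀ : ℝ) : star ⁻¹' U3 q₀ = U4 q₀ := by
  ext z; simp [U3, U4]

lemma star_preimage_upper : star ⁻¹' upper = lower := by
  ext z; simp [upper, lower]

lemma star_preimage_lower : star ⁻¹' lower = upper := by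
  ext z; simp [upper, lower]

lemma isOpen_U2 (q₀ : ℝ) : IsOpen (U2 q₀) :=
  isOpen_lower.inter (isOpen_lt continuous_const continuous_norm)

lemma isOpen_U3 (q₀ : ℝ) : IsOpen (U3 q₀) :=
  isOpen_lower.inter (isOpen_lt continuous_norm continuous_const)

lemma U1_subset (h0 : 0 < q₀) : U1 q₀ ⊆ admissible 1 q₀ 0 := fun z hz =>
  mem_admissible_zero (ne_zero_of_im_pos hz.1) hz.1.le (by have := hz.2; gcongr)

lemma U4_subset (q₀ : ℝ) : U4 q₀ ⊆ admissible 1 q₀ 2 := fun z hz =>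
  mem_admissible_two (ne_zero_of_im_pos hz.1) hz.1.le (by have := hz.2; gcongr)

lemma lower_subset (q₀ : ℝ) : lower ⊆ admissible 1 q₀ 1 := fun z hz =>
  mem_admissible_one (fun h => by simp [lower, h] at hz) (le_of_lt hz)

lemma normC_ne_zero_U1 (h0 : 0 < q₀) {z : ℂ} (hz : z ∈ U1 q₀) : normC q₀ z 0 ≠ 0 :=
  one_add_ne_zero_of_norm_ne h0 (ne_zero_of_im_pos hz.1) hz.2.ne'

lemma normC_ne_zero_U4 (h0 : 0 < q₀) {z : ℂ} (hz : z ∈ U4 q₀) : normC q₀ z 2 ≠ 0 :=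
  one_add_ne_zero_of_norm_ne h0 (ne_zero_of_im_pos hz.1) hz.2.ne

lemma areScatteringCoefficients (h : IsPotential q₀ qm qp u) :
    AreScatteringCoefficients σ q₀ qm qp u t (sCoef q₀ qm qp u 0) (sCoef q₀ qm qp u 1)
      (sCoef q₀ qm qp u 2) (hCoef q₀ qm qp u 0) (hCoef q₀ qm qp u 1) (hCoef q₀ qm qp u 2) where
  isS₁₁ := isSCoeff_sCoef h (isOpen_U1 q₀) (realOuter_subset h.pos) (U1_subset h.pos)
    fun _ hz => normC_ne_zero_U1 h.pos hz
  isS₂₂ := isSCoeff_sCoef h isOpen_lower subset_rfl (lower_subset q₀) fun _ _ => one_ne_zero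
  isS₃₃ := isSCoeff_sCoef h (isOpen_U4 q₀) (realInner_subset q₀) (U4_subset q₀)
    fun _ hz => normC_ne_zero_U4 h.pos hz
  isH₁₁ := isHCoeff_hCoef h (isOpen_U2 q₀) (realOuter_subset h.pos)
    (by rw [star_preimage_U2]; exact U1_subset h.pos)
    fun z hz => normC_ne_zero_U1 h.pos (star_preimage_U2 q₀ ▸ hz : z ∈ U1 q₀)
  isH₂₂ := isHCoeff_hCoef h isOpen_upper subset_rfl
    (by rw [star_preimage_upper]; exact lower_subset q₀) fun _ _ => one_ne_zero
  isH₃₃ := isHCoeff_hCoef h (isOpen_U3 q₀) (realInner_subset q₀)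
    (by rw [star_preimage_U3]; exact U4_subset q₀)
    fun z hz => normC_ne_zero_U4 h.pos (star_preimage_U3 q₀ ▸ hz : z ∈ U4 q₀)

/-- The disc of radius `1` about `q₀ + 1` is the neighbourhood used for boundary uniqueness on the
outer domains; the next two lemmas serve the inner domains (centre and radius `q₀ / 2`) and the
half-planes (centre and radius `1`). -/
lemma norm_gt_of_near {z : ℂ} (h0 : 0 < q₀) (hz : ‖z - ((q₀ + 1 : ℝ) : ℂ)‖ < 1) : q₀ < ‖z‖ := by
  have h1 := norm_sub_norm_le ((q₀ + 1 : ℝ) : ℂ) z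
  rw [Complex.norm_real, Real.norm_of_nonneg (by linarith), norm_sub_rev] at h1
  linarith

lemma norm_lt_of_near {z : ℂ} (h0 : 0 < q₀) (hz : ‖z - ((q₀ / 2 : ℝ) : ℂ)‖ < q₀ / 2) :
    ‖z‖ < q₀ ∧ z ≠ 0 := by
  have h1 := norm_sub_norm_le z ((q₀ / 2 : ℝ) : ℂ)
  rw [Complex.norm_real, Real.norm_of_nonneg (by linarith)] at h1
  refine ⟨by linarith, ?_⟩
  rintro rfl
  rw [zero_sub, norm_neg, Complex.norm_real, Real.norm_of_nonneg (by linarith)] at hz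
  exact lt_irrefl _ hz

lemma ne_zero_of_near {z : ℂ} (hz : ‖z - ((1 : ℝ) : ℂ)‖ < 1) : z ≠ 0 := by
  rintro rfl
  simp at hz

/-- The analytic scattering coefficients are unique. -/
lemma AreScatteringCoefficients.eqOn (h : IsPotential q₀ qm qp u)
    {s₁₁ s₂₂ s₃₃ h₁₁ h₂₂ h₃₃ : ℂ → ℂ}
    (hc : AreScatteringCoefficients σ q₀ qm qp u t s₁₁ s₂₂ s₃₃ h₁₁ h₂₂ h₃₃) :
    EqOn s₁₁ (sCoef q₀ qm qp u 0) (U1 q₀) ∧ EqOn s₂₂ (sCoef q₀ qm qp u 1) lower ∧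
    EqOn s₃₃ (sCoef q₀ qm qp u 2) (U4 q₀) ∧ EqOn h₁₁ (hCoef q₀ qm qp u 0) (U2 q₀) ∧
    EqOn h₂₂ (hCoef q₀ qm qp u 1) upper ∧ EqOn h₃₃ (hCoef q₀ qm qp u 2) (U3 q₀) := by
  have hc' := areScatteringCoefficients (σ := σ) (t := t) h
  have hq := half_pos h.pos
  refine ⟨?_, ?_, ?_, ?_, ?_, ?_⟩
  · exact eqOn_of_real_boundary (isPreconnected_U1 h.pos) hc.isS₁₁.analytic hc'.isS₁₁.analytic
      hc.isS₁₁.continuousOn hc'.isS₁₁.continuousOn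
      (fun z hz => hc.isS₁₁.eq_sCoef h (realOuter_subset h.pos) hz) one_pos
      (fun z hz him => ⟨him, norm_gt_of_near h.pos hz⟩)
      (fun z hz him => ⟨him, norm_gt_of_near h.pos hz⟩)
  · exact eqOn_of_real_boundary_star isOpen_lower
      (by rw [star_preimage_lower]; exact isPreconnected_upper) subset_rfl
      hc.isS₂₂.analytic hc'.isS₂₂.analytic hc.isS₂₂.continuousOn hc'.isS₂₂.continuousOn
      (fun z hz => hc.isS₂₂.eq_sCoef h subset_rfl hz) one_pos
      (fun z _ him => (star_preimage_lower ▸ him : z ∈ star ⁻¹' lower))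
      (fun z hz him => ⟨him, ne_zero_of_near hz⟩)
  · exact eqOn_of_real_boundary (isPreconnected_U4 q₀) hc.isS₃₃.analytic hc'.isS₃₃.analytic
      hc.isS₃₃.continuousOn hc'.isS₃₃.continuousOn
      (fun z hz => hc.isS₃₃.eq_sCoef h (realInner_subset q₀) hz) hq
      (fun z hz him => ⟨him, (norm_lt_of_near h.pos hz).1⟩)
      (fun z hz him => ⟨him, (norm_lt_of_near h.pos hz).2, (norm_lt_of_near h.pos hz).1⟩)
  · exact eqOn_of_real_boundary_star (isOpen_U2 q₀)
      (by rw [star_preimage_U2]; exact isPreconnected_U1 h.pos) (realOuter_subset h.pos)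
      hc.isH₁₁.analytic hc'.isH₁₁.analytic hc.isH₁₁.continuousOn hc'.isH₁₁.continuousOn
      (fun z hz => hc.isH₁₁.eq_hCoef h (realOuter_subset h.pos) hz) one_pos
      (fun z hz him => (star_preimage_U2 q₀ ▸ ⟨him, norm_gt_of_near h.pos hz⟩ :
        z ∈ star ⁻¹' U2 q₀))
      (fun z hz him => ⟨him, norm_gt_of_near h.pos hz⟩)
  · exact eqOn_of_real_boundary isPreconnected_upper hc.isH₂₂.analytic hc'.isH₂₂.analytic
      hc.isH₂₂.continuousOn hc'.isH₂₂.continuousOn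
      (fun z hz => hc.isH₂₂.eq_hCoef h subset_rfl hz) one_pos
      (fun z _ him => him) (fun z hz him => ⟨him, ne_zero_of_near hz⟩)
  · exact eqOn_of_real_boundary_star (isOpen_U3 q₀)
      (by rw [star_preimage_U3]; exact isPreconnected_U4 q₀) (realInner_subset q₀)
      hc.isH₃₃.analytic hc'.isH₃₃.analytic hc.isH₃₃.continuousOn hc'.isH₃₃.continuousOn
      (fun z hz => hc.isH₃₃.eq_hCoef h (realInner_subset q₀) hz) hq
      (fun z hz him => (star_preimage_U3 q₀ ▸ ⟨him, (norm_lt_of_near h.pos hz).1⟩ :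
        z ∈ star ⁻¹' U3 q₀))
      (fun z hz him => ⟨him, (norm_lt_of_near h.pos hz).2, (norm_lt_of_near h.pos hz).1⟩)

end Assembly

end CoupledLPD
end

open CoupledLPD Set in
theorem mainTheorem9 (σ : ℝ) (qvec : CoupledLPD.V) (hqvec : qvec ≠ 0) (q₀ : ℝ) (hq₀ : q₀ = ‖qvec‖)
    (δm δp : ℝ) (qm qp : CoupledLPD.V)
    (hqm : qm = Complex.exp (Complex.I * δm) • qvec)
    (hqp : qp = Complex.exp (Complex.I * δp) • qvec)
    (q : ℝ → ℝ → CoupledLPD.V) (t : ℝ)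
    (hm : ∀ a : ℝ, IntegrableOn (fun x => q x t - qm) (Set.Iio a))
    (hp : ∀ a : ℝ, IntegrableOn (fun x => q x t - qp) (Set.Ioi a)) :
    (∃ s₁₁ s₂₂ s₃₃ h₁₁ h₂₂ h₃₃ : ℂ → ℂ,
      CoupledLPD.AreScatteringCoefficients σ q₀ qm qp (fun x => q x t) t
        s₁₁ s₂₂ s₃₃ h₁₁ h₂₂ h₃₃) ∧
    ∀ s₁₁ s₂₂ s₃₃ h₁₁ h₂₂ h₃₃ : ℂ → ℂ,
      CoupledLPD.AreScatteringCoefficients σ q₀ qm qp (fun x => q x t) t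
        s₁₁ s₂₂ s₃₃ h₁₁ h₂₂ h₃₃ →
      (∀ z : ℂ, 0 < z.im →
        (h₂₂ z = 0 ↔ s₂₂ (star z) = 0) ∧
        (s₂₂ (star z) = 0 ↔ s₂₂ (-(q₀ : ℂ) ^ 2 / star z) = 0) ∧
        (s₂₂ (-(q₀ : ℂ) ^ 2 / star z) = 0 ↔ h₂₂ (-(q₀ : ℂ) ^ 2 / z) = 0)) ∧
      (∀ z ∈ CoupledLPD.U1 q₀,
        (s₁₁ z = 0 ↔ h₁₁ (star z) = 0) ∧
        (h₁₁ (star z) = 0 ↔ h₃₃ (-(q₀ : ℂ) ^ 2 / star z) = 0) ∧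
        (h₃₃ (-(q₀ : ℂ) ^ 2 / star z) = 0 ↔ s₃₃ (-(q₀ : ℂ) ^ 2 / z) = 0)) := by
  have hnorm : ∀ δ : ℝ, ‖Complex.exp (Complex.I * δ) • qvec‖ = q₀ := fun δ => by
    rw [norm_smul, mul_comm, mul_comm Complex.I, Complex.norm_exp_ofReal_mul_I, mul_one, hq₀]
  have h : IsPotential q₀ qm qp fun x => q x t :=
    ⟨hq₀ ▸ norm_pos_iff.2 hqvec, hqm ▸ hnorm δm, hqp ▸ hnorm δp, hm, hp⟩
  have h0 := h.pos.ne'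
  refine ⟨⟨_, _, _, _, _, _, areScatteringCoefficients h⟩, ?_⟩
  intro s₁₁ s₂₂ s₃₃ h₁₁ h₂₂ h₃₃ hc
  obtain ⟨e1, e2, e3, e4, e5, e6⟩ := hc.eqOn h
  refine ⟨fun z hz => ?_, fun z hz => ?_⟩
  · have hz0 := ne_zero_of_im_pos hz
    have hsz := symm_im_pos h0 hz
    have m1 : star z ∈ lower := by change (star z).im < 0; simpa using hz
    have m2 : -(q₀ : ℂ) ^ 2 / star z ∈ lower := by
      rw [← star_symm]
      change (star (-(q₀ : ℂ) ^ 2 / z)).im < 0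
      rw [Complex.star_def, Complex.conj_im]
      exact neg_lt_zero.2 hsz
    -- In terms of the explicit coefficients, all four values are `s₂₂(z*)` or its conjugate.
    rw [e5 hz, e5 hsz, e2 m1, e2 m2, hCoef, hCoef, star_symm, sCoef_one_symm h0 (star_ne_zero.2 hz0),
      star_eq_zero]
    exact ⟨Iff.rfl, Iff.rfl, Iff.rfl⟩
  · have hz0 := ne_zero_of_im_pos hz.1
    have hsz := symm_mem_U4 h.pos hz
    have m1 : star z ∈ U2 q₀ := by
      rw [← mem_preimage, star_preimage_U2]
      exact hz
    have m2 : -(q₀ : ℂ) ^ 2 / star z ∈ U3 q₀ := by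
      rw [← star_symm, ← mem_preimage, star_preimage_U3]
      exact hsz
    have hs : sCoef q₀ qm qp (fun x => q x t) 0 z =
        sCoef q₀ qm qp (fun x => q x t) 2 (-(q₀ : ℂ) ^ 2 / z) := by
      rw [← sCoef_zero_symm h0 (ne_zero_of_im_pos hsz.1), symm_symm h0 hz0]
    -- All four values are `s₁₁(z) = s₃₃(-q₀²/z)` or its conjugate.
    rw [e1 hz, e3 hsz, e4 m1, e6 m2, hCoef, hCoef, star_symm, star_star, star_eq_zero, star_eq_zero,
      hs]
    exact ⟨Iff.rfl, Iff.rfl, Iff.rfl⟩
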